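/- Let $d\ge 1$, let $I_\pm=\{\pm1,\dots,\pm d\}$ with $r(\tau)=\mathrm{sign}(\tau)\,e_{|\tau|}\in\mathbb Z^d$ for $\tau\in I_\pm$, and let $\mathcal H=\mathbb C^{2d}\otimes \ell^2(\mathbb Z^d)$ with standard orthonormal basis $|\tau,x\rangle$, $\tau\in I_\pm$, $x\in\mathbb Z^d$. Write $|x|=\max_i|x_i|$ on $\mathbb Z^d$. Let $\mu$ be a probability measure on $\mathbb T=\mathbb R/2\pi\mathbb Z$ with a bounded density, $d\mu(\theta)=l(\theta)\,d\theta$, $0\le l\in L^\infty(\mathbb T)$, and let $\omega=(\omega^\tau_x)_{x\in\mathbb Z^d,\tau\in I_\pm}$ be i.i.d. with law $\mu$. For a unitary matrix $C\in U(2d)$ let $$U_\omega(C)=\mathbb D(\omega)\,S\,(C\otimes\mathbb I),\qquad S|\tau,x\rangle=|\tau,x+r(\tau)\rangle,\qquad \mathbb D(\omega)|\tau,x\rangle=e^{i\omega^\tau_x}|\tau,x\rangle .$$ Let $\pi$ be a permutation of $I_\pm$ such that for every cycle $(\tau,\pi(\tau),\dots,\pi^{m-1}(\tau))$ of $\pi$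 (a fixed point counting as a cycle with $m=1$) one has $\sum_{k=0}^{m-1}r(\pi^k(\tau))=0$, and let $C_\pi\in U(2d)$ be the permutation matrix $C_\pi|\tau\rangle=|\pi(\tau)\rangle$. Theorem. There is $\delta>0$ such that for every $0<s<1/3$ there are finite constants $\gamma>0$ and $c>0$ with the following property: for all $C\in U(2d)$ with $\|C-C_\pi\|\le\delta$ (operator norm on $\mathbb C^{2d}$), all $x,y\in\mathbb Z^d$ with $|x-y|>2$, all $\tau,\sigma\in I_\pm$ and all $z\in\mathbb C$ with $|z|\in(1/2,2)\setminus\{1\}$, $$\mathbb E_\omega\big(\,|\langle\tau,x|(U_\omega(C)-z)^{-1}|\sigma,y\rangle|^s\,\big)\le c\,e^{-\gamma|x-y|}.$$ Here $\delta$ depends only on $d,\mu,\pi$, while $\gamma$ and $c$ may also depend on $s$. (Under these conditions $U_\omega(C)-z$ is boundedly invertible for every $\omega$ and the expectation is that of an integrable random variable.) -/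

import Mathlib

open MeasureTheory

/-- The period `2π` is positive; Mathlib needs this as an instance to equip
`ℝ / 2πℤ` with Lebesgue measure. -/
instance twoPiPosFact : Fact (0 < 2 * Real.pi) := ⟨Real.two_pi_pos⟩

namespace QWalk

/-- The torus `𝕋 = ℝ / 2πℤ`. Its `volume` is the Lebesgue measure `dθ`, of total mass `2π`. -/
abbrev Torus : Type := AddCircle (2 * Real.pi)

/-- The lattice `ℤᵈ`. Its norm `‖x‖` in Mathlib is the maximum norm `max_i |x_i|`. -/
abbrev Site (d : ℕ) : Type := Fin d → ℤ

/-- The coin index set `I_± = {±1, …, ±d}`: the index `±j` is the pair `(j, ±1)`. -/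
abbrev Coin (d : ℕ) : Type := Fin d × ℤˣ

/-- The jump `r(τ) = sign(τ) e_{|τ|}`. -/
def jump {d : ℕ} (τ : Coin d) : Site d := Pi.single τ.1 (τ.2 : ℤ)

/-- Labels `(τ, x)` of the standard basis vectors `|τ, x⟩`. -/
abbrev Label (d : ℕ) : Type := Coin d × Site d

/-- The Hilbert space `ℂ^{2d} ⊗ ℓ²(ℤᵈ)`, realised as `ℓ²(I_± × ℤᵈ)`. -/
abbrev Hil (d : ℕ) : Type := lp (fun _ : Label d => ℂ) 2

/-- The standard basis vector `|τ, x⟩`. -/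
noncomputable def ket {d : ℕ} (τ : Coin d) (x : Site d) : Hil d := lp.single 2 (τ, x) 1

/-! ### Weighted substitution operators -/

theorem sum_weighted_le {d : ℕ} (f : Label d → Label d) (hf : Function.Injective f)
    (w : Label d → ℂ) (hw : ∀ i, ‖w i‖ ≤ 1) (ψ : Hil d) (s : Finset (Label d)) :
    ∑ i ∈ s, ‖w i * ψ (f i)‖ ^ (2 : ENNReal).toReal ≤ ‖ψ‖ ^ (2 : ENNReal).toReal := by
  classical
  calc ∑ i ∈ s, ‖w i * ψ (f i)‖ ^ (2 : ENNReal).toReal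
      ≤ ∑ i ∈ s, ‖ψ (f i)‖ ^ (2 : ENNReal).toReal := by
        refine Finset.sum_le_sum fun i _ => ?_
        refine Real.rpow_le_rpow (norm_nonneg _) ?_ (by norm_num)
        rw [norm_mul]
        exact mul_le_of_le_one_left (norm_nonneg _) (hw i)
    _ = ∑ j ∈ s.image f, ‖ψ j‖ ^ (2 : ENNReal).toReal := by
        rw [Finset.sum_image (fun a _ b _ h => hf h)]
    _ ≤ ‖ψ‖ ^ (2 : ENNReal).toReal := lp.sum_rpow_le_norm_rpow (by norm_num) ψ _

/-- The bounded operator `(W ψ)(i) = w(i) ψ(f(i))` on `ℓ²`, for `f` injective and `|w| ≤ 1`. -/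
noncomputable def wcomp {d : ℕ} (f : Label d → Label d) (hf : Function.Injective f)
    (w : Label d → ℂ) (hw : ∀ i, ‖w i‖ ≤ 1) : Hil d →L[ℂ] Hil d :=
  LinearMap.mkContinuous
    { toFun := fun ψ => ⟨fun i => w i * ψ (f i), memℓp_gen' (sum_weighted_le f hf w hw ψ)⟩
      map_add' := fun ψ φ => by
        ext i
        exact mul_add _ _ _
      map_smul' := fun a ψ => by
        ext i
        exact mul_left_comm _ _ _ }
    1 (fun ψ => by
      rw [one_mul]
      exact lp.norm_le_of_forall_sum_le (by norm_num) (norm_nonneg _)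
        (sum_weighted_le f hf w hw ψ))

theorem wcomp_apply {d : ℕ} (f : Label d → Label d) (hf : Function.Injective f)
    (w : Label d → ℂ) (hw : ∀ i, ‖w i‖ ≤ 1) (ψ : Hil d) (i : Label d) :
    wcomp f hf w hw ψ i = w i * ψ (f i) := rfl

/-! ### The random quantum walk -/

/-- The coin state dependent shift `S`, `S |τ, x⟩ = |τ, x + r(τ)⟩`,
i.e. `(S ψ)(τ, x) = ψ(τ, x - r(τ))`. -/
noncomputable def shiftOp (d : ℕ) : Hil d →L[ℂ] Hil d :=
  wcomp (fun i => (i.1, i.2 - jump i.1))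
    (fun a b h => by
      obtain ⟨h1, h2⟩ := Prod.mk.inj h
      rw [h1] at h2
      exact Prod.ext h1 (sub_left_injective h2))
    (fun _ => 1) (fun _ => by simp)

/-- The operator `|τ⟩⟨σ| ⊗ 𝕀`. -/
noncomputable def coinUnit {d : ℕ} (τ σ : Coin d) : Hil d →L[ℂ] Hil d :=
  wcomp (fun i => (Equiv.swap τ σ i.1, i.2))
    (fun a b h => by
      obtain ⟨h1, h2⟩ := Prod.mk.inj h
      exact Prod.ext ((Equiv.swap τ σ).injective h1) h2)
    (fun i => if i.1 = τ then 1 else 0) (fun i => by split_ifs <;> simp)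

/-- The operator `C ⊗ 𝕀 = ∑_{τ,σ} C_{τ,σ} |τ⟩⟨σ| ⊗ 𝕀`. -/
noncomputable def coinOp {d : ℕ} (C : Matrix (Coin d) (Coin d) ℂ) : Hil d →L[ℂ] Hil d :=
  ∑ τ, ∑ σ, C τ σ • coinUnit τ σ

theorem coinUnit_apply {d : ℕ} (τ σ κ : Coin d) (ψ : Hil d) (x : Site d) :
    coinUnit τ σ ψ (κ, x) = if κ = τ then ψ (σ, x) else 0 := by
  change (if κ = τ then (1 : ℂ) else 0) * ψ (Equiv.swap τ σ κ, x) = _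
  by_cases h : κ = τ
  · subst h
    simp
  · simp [h]

theorem coinOp_apply {d : ℕ} (C : Matrix (Coin d) (Coin d) ℂ) (ψ : Hil d) (τ : Coin d)
    (x : Site d) : coinOp C ψ (τ, x) = ∑ σ, C τ σ * ψ (σ, x) := by
  have h : lp.evalₗ (fun _ : Label d => ℂ) 2 (𝕜 := ℂ) (τ, x) (coinOp C ψ)
      = ∑ κ, ∑ σ, C κ σ * (if τ = κ then ψ (σ, x) else 0) := by
    simp only [coinOp, _root_.sum_apply, _root_.smul_apply, map_sum,
      map_smul, smul_eq_mul]
    refine Finset.sum_congr rfl fun κ _ => Finset.sum_congr rfl fun σ _ => ?_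
    congr 1
    exact coinUnit_apply κ σ τ ψ x
  refine h.trans ?_
  rw [Finset.sum_eq_single τ] <;> simp +contextual [eq_comm]

/-- A realisation `ω` of the phases `ω_x^τ ∈ 𝕋`. -/
abbrev Phases (d : ℕ) : Type := Label d → Torus

/-- The law of the i.i.d. phases: the infinite product of copies of `μ`. -/
noncomputable def phaseLaw (d : ℕ) (μ : Measure Torus) [IsProbabilityMeasure μ] :
    Measure (Phases d) :=
  Measure.infinitePi (fun _ : Label d => μ)

/-- The diagonal random operator `𝔻(ω) |τ, x⟩ = e^{i ω_x^τ} |τ, x⟩`. -/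
noncomputable def phaseOp {d : ℕ} (ω : Phases d) : Hil d →L[ℂ] Hil d :=
  wcomp id Function.injective_id (fun i => (AddCircle.toCircle (ω i) : ℂ))
    (fun _ => Circle.norm_coe _ |>.le)

/-- The one-step evolution `U_ω(C) = 𝔻(ω) S (C ⊗ 𝕀)`. -/
noncomputable def walk {d : ℕ} (ω : Phases d) (C : Matrix (Coin d) (Coin d) ℂ) :
    Hil d →L[ℂ] Hil d :=
  phaseOp ω ∘L shiftOp d ∘L coinOp C

/-- The resolvent `(U_ω(C) - z)⁻¹` (and `0` when `U_ω(C) - z` is not invertible). -/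
noncomputable def res {d : ℕ} (ω : Phases d) (C : Matrix (Coin d) (Coin d) ℂ) (z : ℂ) :
    Hil d →L[ℂ] Hil d :=
  Ring.inverse (walk ω C - z • ContinuousLinearMap.id ℂ (Hil d))

/-! ### Hypotheses -/

/-- `μ` has a bounded density: `dμ(θ) = l(θ) dθ` with `0 ≤ l ∈ L^∞(𝕋)`. -/
def HasBoundedDensity (μ : Measure Torus) : Prop :=
  ∃ l : Torus → ℝ, MemLp l ⊤ volume ∧ (∀ θ, 0 ≤ l θ) ∧
    μ = volume.withDensity (fun θ => ENNReal.ofReal (l θ))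

/-- The permutation matrix `C_π |τ⟩ = |π(τ)⟩`. -/
def permCoin {d : ℕ} (π : Equiv.Perm (Coin d)) : Matrix (Coin d) (Coin d) ℂ :=
  Matrix.of fun σ τ => if σ = π τ then 1 else 0

/-- Along every cycle `(τ, π(τ), …, π^{m-1}(τ))` of `π`, with `m` the period of `τ`, the jumps
add up to zero. (A fixed point is a cycle of length one, so it is excluded.) -/
def JumpsCancel {d : ℕ} (π : Equiv.Perm (Coin d)) : Prop :=
  ∀ τ : Coin d, ∑ s ∈ Finset.range (Function.minimalPeriod π τ), jump ((π ^ s) τ) = 0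

/-- The operator norm of a matrix acting on the Hilbert space `ℂ^{2d}`. -/
noncomputable def coinNorm {d : ℕ} (A : Matrix (Coin d) (Coin d) ℂ) : ℝ :=
  ‖Matrix.toEuclideanCLM (𝕜 := ℂ) A‖

end QWalk

open QWalk

/-! For `|z| < 1`, factoring out the phases turns the entries of the resolvent into Green functions
`G i j` of `S (C ⊗ 𝕀) - z 𝔻(ω)⁻¹`, up to a phase. Changing the single phase `ω i` is a rank-one
perturbation, so `G i j` is a quantity independent of `ω i` divided by `1 - p e^{-iω i}`, with `p`
independent of `ω i` and `|p| < 1`; likewise for `ω j`. As the law of the phases has a bounded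
density, all moments of order `s < 1` are bounded, uniformly in `z`.

At `C = C_π` the walk carries every label around a loop. Following the loop of `i` for general `C`
expresses `(1 - q e^{-iω i}) G i j`, with `q` independent of `ω i` and `|q| < 1`, as a sum of Green
functions `G k j` with `k` near `i` and coefficients of size `‖C - C_π‖`. Averaging over `ω i`
removes the prefactor, since a lower bound for the average of `|1 - q e^{-iω i}|^s` decouples it
from the denominator `1 - p e^{-iω i}`. For `C` near `C_π`, the moment of order `1/2` is therefore
halved on a fixed length scale and decays exponentially; interpolation with the bounded moments
gives the other orders with the same `δ`. The reflection `z ↦ (star z)⁻¹` reduces `|z| > 1` to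
`|z| < 1`. -/

namespace QWalk

/-! ### Resampling and fractional moments -/

section Resampling

variable {ι : Type*} [DecidableEq ι] {X : ι → Type*} [∀ k, MeasurableSpace (X k)]
  (μ : ∀ k, Measure (X k)) [∀ k, IsProbabilityMeasure (μ k)]

theorem measurePreserving_update_infinitePi (i : ι) :
    MeasurePreserving (fun p : (∀ k, X k) × X i => Function.update p.1 i p.2)
      ((Measure.infinitePi μ).prod (μ i)) (Measure.infinitePi μ) := by
  refine ⟨measurable_update', Measure.eq_infinitePi _ fun s t ht => ?_⟩
  have hpre : (fun p : (∀ k, X k) × X i => Function.update p.1 i p.2) ⁻¹' Set.pi s t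
      = Set.pi (s.erase i : Finset ι) t ×ˢ (if i ∈ s then t i else Set.univ) := by
    ext ⟨ω, x⟩
    rw [Set.mem_preimage, Set.update_mem_pi_iff, Finset.coe_erase, Set.mem_prod]
    split_ifs with hi <;> simp [hi]
  rw [Measure.map_apply measurable_update' (.pi s.countable_toSet fun k _ => ht k), hpre,
    Measure.prod_prod, Measure.infinitePi_pi _ fun k _ => ht k]
  split_ifs with hi
  · exact Finset.prod_erase_mul s (fun k => μ k (t k)) hi
  · rw [measure_univ, mul_one, Finset.erase_eq_of_notMem hi]

theorem lintegral_infinitePi_update (i : ι) {F : (∀ k, X k) → ENNReal} (hF : Measurable F) :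
    ∫⁻ ω, ∫⁻ x, F (Function.update ω i x) ∂μ i ∂Measure.infinitePi μ
      = ∫⁻ ω, F ω ∂Measure.infinitePi μ := by
  have h := measurePreserving_update_infinitePi μ i
  rw [← h.lintegral_comp hF]
  exact (lintegral_prod _ (hF.comp h.measurable).aemeasurable).symm

end Resampling

section Moments

variable {Ω : Type*} [MeasurableSpace Ω] {P : Measure Ω}

theorem one_le_lintegral_mul_lintegral_inv [IsProbabilityMeasure P] {f : Ω → ENNReal}
    (hf : Measurable f) (h0 : ∀ ω, f ω ≠ 0) (htop : ∀ ω, f ω ≠ ⊤) :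
    1 ≤ (∫⁻ ω, f ω ∂P) * ∫⁻ ω, (f ω)⁻¹ ∂P := by
  have hone : ∀ ω, f ω ^ (1 / 2 : ℝ) * (f ω)⁻¹ ^ (1 / 2 : ℝ) = 1 := fun ω => by
    rw [← ENNReal.mul_rpow_of_nonneg _ _ (by norm_num), ENNReal.mul_inv_cancel (h0 ω) (htop ω),
      ENNReal.one_rpow]
  have hCS := ENNReal.lintegral_mul_norm_pow_le (μ := P) hf.aemeasurable hf.inv.aemeasurable
    (p := 1 / 2) (q := 1 / 2) (by norm_num) (by norm_num) (by norm_num)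
  simp only [Pi.inv_apply, hone, lintegral_one, measure_univ] at hCS
  rwa [← ENNReal.mul_rpow_of_nonneg _ _ (by norm_num), one_div, ENNReal.le_rpow_inv_iff
    two_pos, ENNReal.one_rpow] at hCS

theorem lintegral_rpow_le_of_convexComb {f : Ω → ENNReal} (hf : Measurable f) {p r θ : ℝ}
    (hp : 0 ≤ p) (hr : 0 ≤ r) (hθ0 : 0 ≤ θ) (hθ1 : θ ≤ 1) :
    ∫⁻ ω, f ω ^ (p * θ + r * (1 - θ)) ∂P
      ≤ (∫⁻ ω, f ω ^ p ∂P) ^ θ * (∫⁻ ω, f ω ^ r ∂P) ^ (1 - θ) := by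
  have hθ : 0 ≤ 1 - θ := sub_nonneg.2 hθ1
  refine le_of_eq_of_le (lintegral_congr fun ω => ?_) (ENNReal.lintegral_mul_norm_pow_le
    (hf.pow_const p).aemeasurable (hf.pow_const r).aemeasurable hθ0 hθ (add_sub_cancel θ 1))
  rw [ENNReal.rpow_add_of_nonneg _ _ (mul_nonneg hp hθ0) (mul_nonneg hr hθ), ENNReal.rpow_mul,
    ENNReal.rpow_mul]

theorem integrable_and_integral_le_of_lintegral_enorm_rpow_le {E : Type*} [NormedAddCommGroup E]
    {f : Ω → E} (hf : AEStronglyMeasurable f P) {s b : ℝ} (hs : 0 ≤ s) (hb : 0 ≤ b)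
    (h : ∫⁻ ω, ‖f ω‖ₑ ^ s ∂P ≤ ENNReal.ofReal b) :
    Integrable (fun ω => ‖f ω‖ ^ s) P ∧ ∫ ω, ‖f ω‖ ^ s ∂P ≤ b := by
  have hpos : 0 ≤ᵐ[P] fun ω => ‖f ω‖ ^ s := .of_forall fun ω => by positivity
  have hm : AEStronglyMeasurable (fun ω => ‖f ω‖ ^ s) P :=
    (hf.norm.aemeasurable.pow_const s).aestronglyMeasurable
  have h' : ∫⁻ ω, ENNReal.ofReal (‖f ω‖ ^ s) ∂P ≤ ENNReal.ofReal b := by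
    simpa only [← ENNReal.ofReal_rpow_of_nonneg (norm_nonneg _) hs, ofReal_norm] using h
  refine ⟨⟨hm, (hasFiniteIntegral_iff_ofReal hpos).2 (h'.trans_lt ENNReal.ofReal_lt_top)⟩, ?_⟩
  rw [integral_eq_lintegral_of_nonneg_ae hpos hm]
  exact ENNReal.toReal_le_of_le_ofReal hb h'

theorem sum_rpow_le_sum_rpow {ι : Type*} (t : Finset ι) (f : ι → ENNReal) {s : ℝ} (hs0 : 0 < s)
    (hs1 : s ≤ 1) : (∑ k ∈ t, f k) ^ s ≤ ∑ k ∈ t, f k ^ s :=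
  Finset.le_sum_of_subadditive (· ^ s) (ENNReal.zero_rpow_of_pos hs0).le
    (fun a b => ENNReal.rpow_add_le_add_rpow a b hs0.le hs1) t f

theorem lintegral_rpow_sum_le {ι : Type*} (t : Finset ι) {f : ι → Ω → ENNReal}
    (hf : ∀ k, Measurable (f k)) {s : ℝ} (hs0 : 0 < s) (hs1 : s ≤ 1) :
    ∫⁻ ω, (∑ k ∈ t, f k ω) ^ s ∂P ≤ ∑ k ∈ t, ∫⁻ ω, f k ω ^ s ∂P := by
  rw [← lintegral_finsetSum _ fun k _ => (hf k).pow_const s]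
  exact lintegral_mono fun ω => sum_rpow_le_sum_rpow t (fun k => f k ω) hs0 hs1

end Moments

/-! ### A single phase -/

theorem abs_le_two_mul_norm_one_sub_exp {x : ℝ} (hx : |x| ≤ Real.pi) :
    |x| ≤ 2 * ‖1 - Complex.exp (x * Complex.I)‖ := by
  have hsin := Real.mul_abs_le_abs_sin (x := x / 2) (by rw [abs_div, abs_two]; gcongr)
  have hpi : |x| ≤ 4 / Real.pi * |x| :=
    le_mul_of_one_le_left (abs_nonneg x) ((one_le_div Real.pi_pos).2 Real.pi_le_four)
  rw [norm_sub_rev, mul_comm (x : ℂ), Complex.norm_exp_I_mul_ofReal_sub_one, norm_mul,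
    Real.norm_ofNat, Real.norm_eq_abs]
  calc |x| ≤ 4 / Real.pi * |x| := hpi
    _ = 4 * (2 / Real.pi * |x / 2|) := by rw [abs_div, abs_two]; ring
    _ ≤ 4 * |Real.sin (x / 2)| := by gcongr
    _ = 2 * (2 * |Real.sin (x / 2)|) := by ring

theorem integrableOn_norm_one_sub_exp_rpow_neg {s : ℝ} (hs0 : 0 ≤ s) (hs1 : s < 1) :
    IntegrableOn (fun x : ℝ => ‖1 - Complex.exp (x * Complex.I)‖ ^ (-s))
      (Set.Ioc (-Real.pi) Real.pi) := by
  have hball : Metric.ball (0 : ℝ) Real.pi = Set.Ioo (-Real.pi) Real.pi := by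
    rw [Real.ball_eq_Ioo, zero_sub, zero_add]
  rw [integrableOn_Ioc_iff_integrableOn_Ioo, ← hball]
  refine integrableOn_ball_of_norm_le_rpow (C := 2 ^ s) (α := s) (by simp) (by simpa using hs1)
    ?_ (Measurable.aestronglyMeasurable (by fun_prop))
  have hne : ∀ᵐ x : ℝ, x ≠ 0 := by simp [ae_iff]
  filter_upwards [ae_restrict_mem measurableSet_ball, ae_restrict_of_ae hne] with x hx hx0
  have hlow := abs_le_two_mul_norm_one_sub_exp (mem_ball_zero_iff.1 hx).le
  rw [Real.norm_of_nonneg (by positivity), Real.rpow_neg (norm_nonneg _), Real.rpow_neg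
    (norm_nonneg _), Real.norm_eq_abs, ← div_eq_mul_inv, ← inv_div, ← Real.div_rpow
    (abs_nonneg x) zero_le_two]
  have : 0 < |x| / 2 := by positivity
  gcongr
  linarith

theorem lintegral_enorm_one_sub_toCircle_rpow_neg_lt_top {s : ℝ} (hs0 : 0 ≤ s) (hs1 : s < 1) :
    ∫⁻ θ : Torus, ‖1 - (AddCircle.toCircle θ : ℂ)‖ₑ ^ (-s) < ⊤ := by
  rw [← AddCircle.lintegral_preimage (2 * Real.pi) (-Real.pi),
    show -Real.pi + 2 * Real.pi = Real.pi by ring]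
  refine lt_of_le_of_lt (lintegral_mono_ae ?_) (integrableOn_norm_one_sub_exp_rpow_neg hs0 hs1).2
  have hne : ∀ᵐ x : ℝ, x ≠ 0 := by simp [ae_iff]
  filter_upwards [ae_restrict_mem measurableSet_Ioc, ae_restrict_of_ae hne] with x hx hx0
  have hpos : 0 < ‖1 - Complex.exp (x * Complex.I)‖ := by
    have := abs_le_two_mul_norm_one_sub_exp (abs_le.2 ⟨hx.1.le, hx.2⟩)
    have := abs_pos.2 hx0
    linarith
  rw [AddCircle.toCircle_apply_mk, div_self Real.two_pi_pos.ne', one_mul, Circle.coe_exp,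
    ← ofReal_norm, ENNReal.ofReal_rpow_of_pos hpos, Real.enorm_of_nonneg (by positivity)]

theorem HasBoundedDensity.exists_le_smul_volume {μ : Measure Torus} (hμ : HasBoundedDensity μ) :
    ∃ L : NNReal, μ ≤ L • (volume : Measure Torus) := by
  obtain ⟨l, hl, -, rfl⟩ := hμ
  refine ⟨(eLpNorm l ⊤ volume).toNNReal, ?_⟩
  rw [ENNReal.smul_def, ENNReal.coe_toNNReal hl.2.ne, ← withDensity_const]
  refine withDensity_mono ?_
  filter_upwards [ae_le_eLpNormEssSup (f := l)] with θ hθ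
  rw [← eLpNorm_exponent_top] at hθ
  exact (Real.ofReal_le_enorm _).trans hθ

theorem norm_one_sub_le_two_mul {ρ : ℝ} (hρ : 0 ≤ ρ) {w : ℂ} (hw : ‖w‖ = 1) :
    ‖1 - w‖ ≤ 2 * ‖1 - ρ * w‖ := by
  have hradial : ‖(ρ - 1 : ℂ) * w‖ ≤ ‖1 - ρ * w‖ := by
    have h := abs_norm_sub_norm_le (1 : ℂ) (ρ * w)
    rw [norm_one, norm_mul, hw, mul_one, Complex.norm_of_nonneg hρ, abs_sub_comm] at h
    rwa [norm_mul, hw, mul_one, ← Complex.ofReal_one, ← Complex.ofReal_sub, Complex.norm_real]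
  calc ‖1 - w‖ = ‖(1 - ρ * w) + (ρ - 1 : ℂ) * w‖ := by ring_nf
    _ ≤ ‖1 - ρ * w‖ + ‖1 - ρ * w‖ := (norm_add_le _ _).trans (by gcongr)
    _ = 2 * ‖1 - ρ * w‖ := (two_mul _).symm

/-- The closed unit disc, in which the weights of the diagonal operators live. -/
abbrev Disc : Type := Metric.closedBall (0 : ℂ) 1

theorem Disc.norm_le (v : Disc) : ‖(v : ℂ)‖ ≤ 1 :=
  mem_closedBall_zero_iff.1 v.2

/-- The conjugate phase `e^{-iθ}`, as an element of the closed unit disc. -/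
noncomputable def conjPhase (θ : Torus) : Disc :=
  ⟨AddCircle.toCircle (-θ), mem_closedBall_zero_iff.2 (Circle.norm_coe _).le⟩

theorem norm_conjPhase (θ : Torus) : ‖(conjPhase θ : ℂ)‖ = 1 := Circle.norm_coe _

theorem conjPhase_mul_toCircle (θ : Torus) : (conjPhase θ : ℂ) * AddCircle.toCircle θ = 1 := by
  rw [conjPhase, ← Circle.coe_mul, ← AddCircle.toCircle_add, neg_add_cancel,
    AddCircle.toCircle_zero, Circle.coe_one]

theorem continuous_conjPhase : Continuous conjPhase :=
  (continuous_subtype_val.comp (AddCircle.continuous_toCircle.comp continuous_neg)).subtype_mk _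

theorem measurable_enorm_one_sub_mul_conjPhase_rpow (p : ℂ) (s : ℝ) :
    Measurable fun θ => ‖1 - p * conjPhase θ‖ₑ ^ s := by
  have : Measurable fun θ => (conjPhase θ : ℂ) :=
    (continuous_subtype_val.comp continuous_conjPhase).measurable
  fun_prop

theorem exists_eq_norm_mul_toCircle (p : ℂ) :
    ∃ a : Torus, p = ‖p‖ * AddCircle.toCircle a := by
  refine ⟨(p.arg : ℝ), ?_⟩
  rw [AddCircle.toCircle_apply_mk, div_self Real.two_pi_pos.ne', one_mul, Circle.coe_exp,
    Complex.norm_mul_exp_arg_mul_I]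

theorem one_sub_ne_zero_of_norm_lt_one {p : ℂ} (hp : ‖p‖ < 1) (v : Disc) : 1 - p * v ≠ 0 := by
  intro h
  have h1 : ‖p * (v : ℂ)‖ < 1 := by
    rw [norm_mul]
    exact (mul_le_of_le_one_right (norm_nonneg p) v.norm_le).trans_lt hp
  rw [← sub_eq_zero.1 h, norm_one] at h1
  exact h1.false

theorem rpow_neg_le_two_rpow_mul_rpow_neg {a b : ENNReal} (h : a ≤ 2 * b) {s : ℝ} (hs : 0 ≤ s) :
    b ^ (-s) ≤ 2 ^ s * a ^ (-s) := by
  have h2 : (2 : ENNReal) ^ s ≠ ⊤ := ENNReal.rpow_ne_top_of_nonneg hs (by simp)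
  have h2' : (2 : ENNReal) ^ s ≠ 0 := (ENNReal.rpow_pos two_pos (by simp)).ne'
  have hdiv : a ^ s / 2 ^ s ≤ b ^ s := ENNReal.div_le_of_le_mul' <|
    (ENNReal.rpow_le_rpow h hs).trans_eq (ENNReal.mul_rpow_of_nonneg _ _ hs)
  rw [ENNReal.rpow_neg, ENNReal.rpow_neg, ← div_eq_mul_inv,
    ← ENNReal.inv_div (.inl h2) (.inl h2')]
  exact ENNReal.inv_le_inv' hdiv

theorem exists_lintegral_rpow_neg_le {μ : Measure Torus} (hμ : HasBoundedDensity μ) {s : ℝ}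
    (hs0 : 0 ≤ s) (hs1 : s < 1) :
    ∃ K : NNReal, ∀ p : ℂ, ∫⁻ θ, ‖1 - p * conjPhase θ‖ₑ ^ (-s) ∂μ ≤ K := by
  obtain ⟨L, hL⟩ := hμ.exists_le_smul_volume
  set J := ∫⁻ θ : Torus, ‖1 - (AddCircle.toCircle θ : ℂ)‖ₑ ^ (-s)
  have hfin : (L : ENNReal) * (2 ^ s * J) ≠ ⊤ := ENNReal.mul_ne_top ENNReal.coe_ne_top
    (ENNReal.mul_ne_top (ENNReal.rpow_ne_top_of_nonneg hs0 (by simp))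
      (lintegral_enorm_one_sub_toCircle_rpow_neg_lt_top hs0 hs1).ne)
  refine ⟨((L : ENNReal) * (2 ^ s * J)).toNNReal, fun p => ?_⟩
  rw [ENNReal.coe_toNNReal hfin]
  obtain ⟨a, ha⟩ := exists_eq_norm_mul_toCircle p
  have hpt : ∀ θ, ‖1 - p * conjPhase θ‖ₑ ^ (-s)
      ≤ 2 ^ s * ‖1 - (AddCircle.toCircle (a - θ) : ℂ)‖ₑ ^ (-s) := fun θ => by
    have hrot : p * conjPhase θ = ‖p‖ * (AddCircle.toCircle (a - θ) : ℂ) := by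
      conv_lhs => rw [ha]
      rw [conjPhase, sub_eq_add_neg, AddCircle.toCircle_add, Circle.coe_mul, mul_assoc]
    refine rpow_neg_le_two_rpow_mul_rpow_neg ?_ hs0
    rw [hrot, ← ofReal_norm, ← ofReal_norm, ← ENNReal.ofReal_ofNat 2,
      ← ENNReal.ofReal_mul zero_le_two]
    exact ENNReal.ofReal_le_ofReal (norm_one_sub_le_two_mul (norm_nonneg p) (Circle.norm_coe _))
  calc ∫⁻ θ, ‖1 - p * conjPhase θ‖ₑ ^ (-s) ∂μ
      ≤ ∫⁻ θ, ‖1 - p * conjPhase θ‖ₑ ^ (-s) ∂(L • (volume : Measure Torus)) :=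
        lintegral_mono' hL le_rfl
    _ = L * ∫⁻ θ : Torus, ‖1 - p * conjPhase θ‖ₑ ^ (-s) := lintegral_smul_measure ..
    _ ≤ L * ∫⁻ θ : Torus, 2 ^ s * ‖1 - (AddCircle.toCircle (a - θ) : ℂ)‖ₑ ^ (-s) := by
        gcongr with θ
        exact hpt θ
    _ = L * (2 ^ s * J) := by
        rw [lintegral_const_mul' _ _ (ENNReal.rpow_ne_top_of_nonneg hs0 (by simp)),
          lintegral_sub_left_eq_self
            (fun θ : Torus => ‖1 - (AddCircle.toCircle θ : ℂ)‖ₑ ^ (-s)) a]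

section SinglePhase

variable {μ : Measure Torus} [IsProbabilityMeasure μ] {s : ℝ} {K : ENNReal}

theorem one_le_of_forall_lintegral_rpow_neg_le
    (hK : ∀ p : ℂ, ∫⁻ θ, ‖1 - p * conjPhase θ‖ₑ ^ (-s) ∂μ ≤ K) : 1 ≤ K := by
  simpa using hK 0

-- By Cauchy-Schwarz the average of `|1 - q e^{-iθ}|^s` is at least `K⁻¹`, while
-- `|1 - p e^{-iθ}| ≤ 2` holds pointwise.
theorem lintegral_rpow_neg_le_mul (hs : 0 ≤ s)
    (hK : ∀ p : ℂ, ∫⁻ θ, ‖1 - p * conjPhase θ‖ₑ ^ (-s) ∂μ ≤ K)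
    {p q : ℂ} (hp : ‖p‖ ≤ 1) (hq : ‖q‖ < 1) :
    ∫⁻ θ, ‖1 - p * conjPhase θ‖ₑ ^ (-s) ∂μ
      ≤ 2 ^ s * K ^ 2 * ∫⁻ θ, ‖1 - q * conjPhase θ‖ₑ ^ s * ‖1 - p * conjPhase θ‖ₑ ^ (-s) ∂μ := by
  have h2 : (2 : ENNReal) ^ s ≠ ⊤ := ENNReal.rpow_ne_top_of_nonneg hs (by simp)
  have hlow : 1 ≤ (∫⁻ θ, ‖1 - q * conjPhase θ‖ₑ ^ s ∂μ) * K := by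
    have hCS := one_le_lintegral_mul_lintegral_inv (P := μ)
      (measurable_enorm_one_sub_mul_conjPhase_rpow q s)
      (fun θ => (ENNReal.rpow_pos
        (enorm_pos.2 (one_sub_ne_zero_of_norm_lt_one hq (conjPhase θ))) enorm_ne_top).ne')
      (fun θ => ENNReal.rpow_ne_top_of_nonneg hs enorm_ne_top)
    simp only [← ENNReal.rpow_neg] at hCS
    exact hCS.trans (by gcongr; exact hK q)
  have hpt : ∀ θ, 1 ≤ 2 ^ s * ‖1 - p * conjPhase θ‖ₑ ^ (-s) := fun θ => by
    have h : ‖1 - p * conjPhase θ‖ₑ ≤ 2 * 1 := by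
      rw [← ofReal_norm, mul_one, ← ENNReal.ofReal_ofNat 2]
      refine ENNReal.ofReal_le_ofReal ((norm_sub_le _ _).trans ?_)
      rw [norm_mul, norm_conjPhase, norm_one]
      linarith
    simpa using rpow_neg_le_two_rpow_mul_rpow_neg h hs
  calc ∫⁻ θ, ‖1 - p * conjPhase θ‖ₑ ^ (-s) ∂μ
      ≤ K * ((∫⁻ θ, ‖1 - q * conjPhase θ‖ₑ ^ s * 1 ∂μ) * K) := by
        simpa only [mul_one] using mul_le_mul' (hK p) hlow
    _ ≤ K * ((∫⁻ θ, ‖1 - q * conjPhase θ‖ₑ ^ s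
          * (2 ^ s * ‖1 - p * conjPhase θ‖ₑ ^ (-s)) ∂μ) * K) := by
        gcongr with θ
        exact hpt θ
    _ = _ := by
        simp only [mul_left_comm _ ((2 : ENNReal) ^ s)]
        rw [lintegral_const_mul' _ _ h2]
        ring

end SinglePhase

/-! ### Green functions of a unitary minus a diagonal operator -/

section UnitarySub

variable {A : Type*} [NormedRing A] [StarRing A] [CStarRing A] [CompleteSpace A] {V B : A}

theorem isUnit_unitary_sub (hV : V ∈ unitary A) (hB : ‖B‖ < 1) : IsUnit (V - B) := by
  have hfactor : V - B = V * (1 - star V * B) := by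
    rw [mul_sub, mul_one, ← mul_assoc, Unitary.mul_star_self_of_mem hV, one_mul]
  rw [hfactor]
  refine (Unitary.isUnit_coe (U := ⟨V, hV⟩)).mul (isUnit_one_sub_of_norm_lt_one ?_)
  rwa [CStarRing.norm_mem_unitary_mul B (Unitary.star_mem hV)]

theorem norm_inverse_unitary_sub_le (hV : V ∈ unitary A) (hB : ‖B‖ < 1) :
    ‖Ring.inverse (V - B)‖ ≤ (1 - ‖B‖)⁻¹ := by
  have hone : ‖(1 : A)‖ ≤ 1 := by
    rcases subsingleton_or_nontrivial A with _ | _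
    · rw [Subsingleton.elim (1 : A) 0, norm_zero]
      exact zero_le_one
    · exact CStarRing.norm_one.le
  set R := Ring.inverse (V - B)
  have hR : V * R = 1 + B * R := by
    rw [← sub_eq_iff_eq_add, ← sub_mul]
    exact Ring.mul_inverse_cancel _ (isUnit_unitary_sub hV hB)
  have hnorm : ‖R‖ ≤ 1 + ‖B‖ * ‖R‖ := by
    calc ‖R‖ = ‖1 + B * R‖ := by rw [← hR, CStarRing.norm_mem_unitary_mul R hV]
      _ ≤ 1 + ‖B‖ * ‖R‖ := (norm_add_le _ _).trans (add_le_add hone (norm_mul_le B R))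
  rw [← one_div, le_div_iff₀ (sub_pos.2 hB)]
  linarith

end UnitarySub

section Green

/-- The Hilbert space `ℓ²(ι)`, of which `Hil d` is the case `ι = Label d`. -/
abbrev Ell2 (ι : Type*) : Type _ := lp (fun _ : ι => ℂ) 2

variable {ι : Type*} {V : Ell2 ι →L[ℂ] Ell2 ι} {z : ℂ}

theorem summable_norm_sq (ψ : Ell2 ι) : Summable fun i => ‖ψ i‖ ^ 2 := by
  simpa using (lp.memℓp ψ).summable (by norm_num)

theorem norm_sq_eq_tsum (ψ : Ell2 ι) : ‖ψ‖ ^ 2 = ∑' i, ‖ψ i‖ ^ 2 := by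
  simpa using lp.norm_rpow_eq_tsum (p := 2) (by norm_num) ψ

/-- The diagonal operator with weights `w`. -/
noncomputable def diagOp (w : ι → Disc) : Ell2 ι →L[ℂ] Ell2 ι :=
  lp.mapCLM 2 (fun i => ContinuousLinearMap.mul ℂ ℂ (w i)) zero_le_one
    fun i => (ContinuousLinearMap.opNorm_mul_apply_le ℂ ℂ _).trans (w i).norm_le

theorem diagOp_apply (w : ι → Disc) (ψ : Ell2 ι) (i : ι) : diagOp w ψ i = w i * ψ i := rfl

theorem norm_diagOp_le (w : ι → Disc) : ‖diagOp w‖ ≤ 1 := lp.norm_mapCLM_le ..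

theorem norm_smul_diagOp_lt_one (hz : ‖z‖ < 1) (w : ι → Disc) : ‖z • diagOp w‖ < 1 := by
  rw [norm_smul]
  exact (mul_le_of_le_one_right (norm_nonneg z) (norm_diagOp_le w)).trans_lt hz

theorem isUnit_sub_smul_diagOp (hV : V ∈ unitary (Ell2 ι →L[ℂ] Ell2 ι)) (hz : ‖z‖ < 1)
    (w : ι → Disc) : IsUnit (V - z • diagOp w) :=
  isUnit_unitary_sub hV (norm_smul_diagOp_lt_one hz w)

theorem continuous_diagOp_apply (ψ : Ell2 ι) : Continuous fun w : ι → Disc => diagOp w ψ := by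
  refine continuous_iff_continuousAt.2 fun w₀ => tendsto_iff_norm_sub_tendsto_zero.2 ?_
  have hcoord : ∀ (w : ι → Disc) i, ‖(diagOp w ψ - diagOp w₀ ψ) i‖ ^ 2
      = ‖(w i : ℂ) - w₀ i‖ ^ 2 * ‖ψ i‖ ^ 2 := fun w i => by
    rw [lp.coeFn_sub, Pi.sub_apply, diagOp_apply, diagOp_apply, ← sub_mul, norm_mul, mul_pow]
  have hsq : Continuous fun w : ι → Disc => ‖diagOp w ψ - diagOp w₀ ψ‖ ^ 2 := by
    simp only [norm_sq_eq_tsum, hcoord]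
    refine continuous_tsum (fun i => by fun_prop) ((summable_norm_sq ψ).mul_left (2 ^ 2))
      fun i w => ?_
    rw [Real.norm_of_nonneg (by positivity)]
    gcongr
    refine (norm_sub_le _ _).trans ?_
    linarith [(w i).norm_le, (w₀ i).norm_le]
  have hlim := hsq.sqrt.tendsto w₀
  rwa [sub_self, norm_zero, zero_pow two_ne_zero, Real.sqrt_zero,
    funext fun w => Real.sqrt_sq (norm_nonneg (diagOp w ψ - diagOp w₀ ψ))] at hlim

section Entry

variable [DecidableEq ι]

/-- The matrix entry `⟨i, A j⟩` of an operator in the standard basis. -/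
noncomputable def entry (A : Ell2 ι →L[ℂ] Ell2 ι) (i j : ι) : ℂ := A (lp.single 2 j 1) i

theorem inner_single_apply_single (A : Ell2 ι →L[ℂ] Ell2 ι) (i j : ι) :
    inner ℂ (lp.single 2 i (1 : ℂ) : Ell2 ι) (A (lp.single 2 j 1)) = entry A i j := by
  rw [lp.inner_single_left, RCLike.inner_apply, map_one, mul_one, entry]

theorem entry_one (i j : ι) : entry 1 i j = if i = j then 1 else 0 := by
  rw [entry, one_apply_eq_self, lp.single_apply, Pi.single_apply]

theorem entry_star (A : Ell2 ι →L[ℂ] Ell2 ι) (i j : ι) :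
    entry (star A) i j = star (entry A j i) := by
  rw [← inner_single_apply_single, ContinuousLinearMap.star_eq_adjoint,
    ContinuousLinearMap.adjoint_inner_right, ← inner_conj_symm, inner_single_apply_single,
    starRingEnd_apply]

theorem norm_sq_smul_single_add (a : ℂ) (j : ι) {ψ : Ell2 ι} (hψ : ψ j = 0) :
    ‖a • (lp.single 2 j 1 : Ell2 ι) + ψ‖ ^ 2 = ‖a‖ ^ 2 + ‖ψ‖ ^ 2 := by
  have hinner : inner ℂ (a • (lp.single 2 j 1 : Ell2 ι)) ψ = 0 := by
    rw [inner_smul_left, lp.inner_single_left, hψ, inner_zero_right, mul_zero]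
  rw [sq, norm_add_sq_eq_norm_sq_add_norm_sq_of_inner_eq_zero _ _ hinner, norm_smul,
    lp.norm_single two_pos, norm_one, mul_one, sq, sq]

theorem diagOp_single_one_apply (k : ι) (ψ : Ell2 ι) :
    diagOp (Pi.single k 1) ψ = ψ k • lp.single 2 k 1 := by
  ext i
  rw [diagOp_apply, lp.coeFn_smul, Pi.smul_apply, lp.single_apply]
  rcases eq_or_ne i k with rfl | hik
  · simp
  · simp [hik]

theorem diagOp_update (w : ι → Disc) (k : ι) (v : Disc) :
    diagOp (Function.update w k v)
      = diagOp (Function.update w k 0) + (v : ℂ) • diagOp (Pi.single k 1) := by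
  ext ψ i
  simp only [_root_.add_apply, _root_.smul_apply, lp.coeFn_add, lp.coeFn_smul, Pi.add_apply,
    Pi.smul_apply, diagOp_apply]
  rcases eq_or_ne i k with rfl | hik
  · simp
  · simp [hik]

theorem entry_mul_diagOp_single_mul (A B : Ell2 ι →L[ℂ] Ell2 ι) (i j k : ι) :
    entry (A * diagOp (Pi.single k 1) * B) i j = entry A i k * entry B k j := by
  rw [entry, mul_apply_eq_comp, mul_apply_eq_comp, diagOp_single_one_apply, map_smul,
    lp.coeFn_smul, Pi.smul_apply, smul_eq_mul, mul_comm, entry, entry]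

end Entry

theorem norm_sq_add_norm_sq_diagOp_le {w : ι → Disc} {i : ι} (hi : w i = 0) (ψ : Ell2 ι) :
    ‖ψ i‖ ^ 2 + ‖diagOp w ψ‖ ^ 2 ≤ ‖ψ‖ ^ 2 := by
  classical
  have hsplit : diagOp (Function.update w i 1) ψ = ψ i • lp.single 2 i 1 + diagOp w ψ := by
    rw [diagOp_update, _root_.add_apply, _root_.smul_apply, diagOp_single_one_apply, ← hi,
      Function.update_eq_self, Metric.unitClosedBall.coe_one, one_smul, add_comm]
  have hzero : diagOp w ψ i = 0 := by
    rw [diagOp_apply, hi, Metric.unitClosedBall.coe_zero, zero_mul]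
  rw [← norm_sq_smul_single_add _ i hzero, ← hsplit]
  gcongr
  simpa only [one_mul] using (diagOp _).le_of_opNorm_le (norm_diagOp_le _) ψ

variable [DecidableEq ι]

/-- The Green function `⟨i, (V - z D)⁻¹ j⟩`, where `D` is the diagonal operator with weights `w`. -/
noncomputable def green (V : Ell2 ι →L[ℂ] Ell2 ι) (z : ℂ) (w : ι → Disc) (i j : ι) : ℂ :=
  entry (Ring.inverse (V - z • diagOp w)) i j

theorem apply_inverse_single (hV : V ∈ unitary (Ell2 ι →L[ℂ] Ell2 ι)) (hz : ‖z‖ < 1)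
    (w : ι → Disc) (j : ι) :
    V (Ring.inverse (V - z • diagOp w) (lp.single 2 j 1)) = (1 : ℂ) • lp.single 2 j 1
      + z • diagOp w (Ring.inverse (V - z • diagOp w) (lp.single 2 j 1)) := by
  rw [one_smul, ← sub_eq_iff_eq_add, ← _root_.smul_apply, ← _root_.sub_apply,
    ← mul_apply_eq_comp, Ring.mul_inverse_cancel _ (isUnit_sub_smul_diagOp hV hz w),
    one_apply_eq_self]

-- As `w j = 0`, the two terms of `V ψ = e_j + z D ψ` are orthogonal, while `w i = 0` leaves room
-- for `|ψ i|²` next to `‖D ψ‖²` in `‖ψ‖²`.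
theorem norm_green_le_one (hV : V ∈ unitary (Ell2 ι →L[ℂ] Ell2 ι)) (hz : ‖z‖ < 1)
    {w : ι → Disc} {i j : ι} (hi : w i = 0) (hj : w j = 0) : ‖green V z w i j‖ ≤ 1 := by
  set ψ := Ring.inverse (V - z • diagOp w) (lp.single 2 j 1) with hψ
  have hzero : (z • diagOp w ψ) j = 0 := by
    rw [lp.coeFn_smul, Pi.smul_apply, diagOp_apply, hj, Metric.unitClosedBall.coe_zero, zero_mul,
      smul_zero]
  have hnorm : ‖ψ‖ ^ 2 = 1 + ‖z‖ ^ 2 * ‖diagOp w ψ‖ ^ 2 := by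
    rw [← ContinuousLinearMap.norm_map_of_mem_unitary hV ψ, hψ, apply_inverse_single hV hz, ← hψ,
      norm_sq_smul_single_add _ _ hzero, norm_smul, norm_one, mul_pow, one_pow]
  have hle := norm_sq_add_norm_sq_diagOp_le hi ψ
  have hz2 : ‖z‖ ^ 2 * ‖diagOp w ψ‖ ^ 2 ≤ ‖diagOp w ψ‖ ^ 2 :=
    mul_le_of_le_one_left (by positivity) (pow_le_one₀ (norm_nonneg _) hz.le)
  refine (sq_le_one_iff₀ (norm_nonneg (ψ i))).1 ?_
  linarith

theorem continuous_green (hV : V ∈ unitary (Ell2 ι →L[ℂ] Ell2 ι)) (hz : ‖z‖ < 1) (i j : ι) :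
    Continuous fun w => green V z w i j := by
  refine continuous_iff_continuousAt.2 fun w₀ => tendsto_iff_norm_sub_tendsto_zero.2 ?_
  set ψ := Ring.inverse (V - z • diagOp w₀) (lp.single 2 j 1)
  have : 0 < 1 - ‖z‖ := sub_pos.2 hz
  have hbound : ∀ w, ‖green V z w i j - green V z w₀ i j‖
      ≤ (1 - ‖z‖)⁻¹ * ‖z • (diagOp w ψ - diagOp w₀ ψ)‖ := fun w => by
    have hres : Ring.inverse (V - z • diagOp w) (lp.single 2 j 1) - ψ
        = Ring.inverse (V - z • diagOp w) (z • (diagOp w ψ - diagOp w₀ ψ)) := by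
      have h := Ring.inverse_sub_inverse (iff_of_true (isUnit_sub_smul_diagOp hV hz w)
        (isUnit_sub_smul_diagOp hV hz w₀))
      rw [sub_sub_sub_cancel_left, ← smul_sub] at h
      exact congrArg (fun T : Ell2 ι →L[ℂ] Ell2 ι => T (lp.single 2 j 1)) h
    have hR : ‖Ring.inverse (V - z • diagOp w)‖ ≤ (1 - ‖z‖)⁻¹ := by
      refine (norm_inverse_unitary_sub_le hV (norm_smul_diagOp_lt_one hz w)).trans ?_
      gcongr
      rw [norm_smul]
      exact mul_le_of_le_one_right (norm_nonneg z) (norm_diagOp_le w)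
    refine (lp.norm_apply_le_norm two_ne_zero
      (Ring.inverse (V - z • diagOp w) (lp.single 2 j 1) - ψ) i).trans ?_
    rw [hres]
    exact ContinuousLinearMap.le_of_opNorm_le _ hR _
  refine squeeze_zero (fun _ => norm_nonneg _) hbound ?_
  have hcont : Continuous fun w => (1 - ‖z‖)⁻¹ * ‖z • (diagOp w ψ - diagOp w₀ ψ)‖ := by
    have := continuous_diagOp_apply ψ
    fun_prop
  simpa using hcont.tendsto w₀

theorem green_update_mul (hV : V ∈ unitary (Ell2 ι →L[ℂ] Ell2 ι)) (hz : ‖z‖ < 1) (w : ι → Disc)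
    {i j k : ι} (hk : k = i ∨ k = j) (v : Disc) :
    green V z (Function.update w k v) i j * (1 - z * green V z (Function.update w k 0) k k * v)
      = green V z (Function.update w k 0) i j := by
  set a := V - z • diagOp (Function.update w k v)
  set b := V - z • diagOp (Function.update w k 0)
  have hab : b - a = (z * v) • diagOp (Pi.single k 1) := by
    rw [sub_sub_sub_cancel_left, ← smul_sub, diagOp_update, add_sub_cancel_left, smul_smul]
  have ha : IsUnit a := isUnit_sub_smul_diagOp hV hz _
  have hb : IsUnit b := isUnit_sub_smul_diagOp hV hz _
  rcases hk with rfl | rfl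
  · have h : entry (Ring.inverse b) k j - entry (Ring.inverse a) k j
        = -(z * v) * (entry (Ring.inverse b) k k * entry (Ring.inverse a) k j) := by
      rw [← entry_mul_diagOp_single_mul]
      have := Ring.inverse_sub_inverse (iff_of_true hb ha)
      rw [← neg_sub b a, hab, ← neg_smul, mul_smul_comm, smul_mul_assoc] at this
      exact congrArg (entry · k j) this
    unfold green
    linear_combination -h
  · have h : entry (Ring.inverse a) i k - entry (Ring.inverse b) i k
        = (z * v) * (entry (Ring.inverse a) i k * entry (Ring.inverse b) k k) := by
      rw [← entry_mul_diagOp_single_mul]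
      have := Ring.inverse_sub_inverse (iff_of_true ha hb)
      rw [hab, mul_smul_comm, smul_mul_assoc] at this
      exact congrArg (entry · i k) this
    unfold green
    linear_combination h

theorem norm_mul_green_update_zero_lt_one (hV : V ∈ unitary (Ell2 ι →L[ℂ] Ell2 ι))
    (hz : ‖z‖ < 1) (w : ι → Disc) (k : ι) : ‖z * green V z (Function.update w k 0) k k‖ < 1 := by
  rw [norm_mul]
  exact (mul_le_of_le_one_right (norm_nonneg z) (norm_green_le_one hV hz
    (Function.update_self ..) (Function.update_self ..))).trans_lt hz

theorem enorm_green_update_rpow (hV : V ∈ unitary (Ell2 ι →L[ℂ] Ell2 ι)) (hz : ‖z‖ < 1)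
    (w : ι → Disc) {i j k : ι} (hk : k = i ∨ k = j) (v : Disc) {s : ℝ} (hs : 0 ≤ s) :
    ‖green V z (Function.update w k v) i j‖ₑ ^ s
      = ‖green V z (Function.update w k 0) i j‖ₑ ^ s
        * ‖1 - z * green V z (Function.update w k 0) k k * v‖ₑ ^ (-s) := by
  have hne := enorm_pos.2
    (one_sub_ne_zero_of_norm_lt_one (norm_mul_green_update_zero_lt_one hV hz w k) v)
  rw [← green_update_mul hV hz w hk v, enorm_mul, ENNReal.mul_rpow_of_nonneg _ _ hs, mul_assoc,
    ENNReal.rpow_neg, ENNReal.mul_inv_cancel (ENNReal.rpow_pos hne enorm_ne_top).ne'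
    (ENNReal.rpow_ne_top_of_nonneg hs enorm_ne_top), mul_one]

end Green

/-! ### Averages over the phases -/

section GreenMoment

variable {ι : Type*} {V : Ell2 ι →L[ℂ] Ell2 ι} {z : ℂ} {μ : Measure Torus}
  {s : ℝ} {K : ENNReal}

/-- The weights `e^{-iω}` of the diagonal operator `𝔻(ω)⁻¹`. -/
noncomputable def weights (ω : ι → Torus) : ι → Disc := conjPhase ∘ ω

theorem continuous_weights : Continuous (weights : (ι → Torus) → ι → Disc) :=
  continuous_pi fun i => continuous_conjPhase.comp (continuous_apply i)

variable [DecidableEq ι]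

theorem weights_update (ω : ι → Torus) (k : ι) (θ : Torus) :
    weights (Function.update ω k θ) = Function.update (weights ω) k (conjPhase θ) :=
  Function.comp_update ..

theorem lintegral_green_update_le (hV : V ∈ unitary (Ell2 ι →L[ℂ] Ell2 ι)) (hz : ‖z‖ < 1)
    (hs : 0 ≤ s) (hK : ∀ p : ℂ, ∫⁻ θ, ‖1 - p * conjPhase θ‖ₑ ^ (-s) ∂μ ≤ K) (w : ι → Disc)
    {i j k : ι} (hk : k = i ∨ k = j) :
    ∫⁻ θ, ‖green V z (Function.update w k (conjPhase θ)) i j‖ₑ ^ s ∂μ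
      ≤ ‖green V z (Function.update w k 0) i j‖ₑ ^ s * K := by
  have hg := fun θ => enorm_green_update_rpow hV hz w hk (conjPhase θ) hs
  simp only [hg]
  rw [lintegral_const_mul' _ _ (ENNReal.rpow_ne_top_of_nonneg hs enorm_ne_top)]
  gcongr
  exact hK _

/-- The averaged fractional moment `𝔼 |⟨i, (V - z 𝔻(ω)⁻¹)⁻¹ j⟩|^s` over i.i.d. phases of law `μ`. -/
noncomputable def greenMoment (μ : Measure Torus) [IsProbabilityMeasure μ]
    (V : Ell2 ι →L[ℂ] Ell2 ι) (z : ℂ) (s : ℝ) (i j : ι) : ENNReal :=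
  ∫⁻ ω, ‖green V z (weights ω) i j‖ₑ ^ s ∂Measure.infinitePi fun _ : ι => μ

variable [IsProbabilityMeasure μ] [Countable ι]

theorem measurable_green_weights (hV : V ∈ unitary (Ell2 ι →L[ℂ] Ell2 ι)) (hz : ‖z‖ < 1)
    (i j : ι) : Measurable fun ω => green V z (weights ω) i j :=
  ((continuous_green hV hz i j).comp continuous_weights).measurable

theorem lintegral_green_update_zero_le (hV : V ∈ unitary (Ell2 ι →L[ℂ] Ell2 ι)) (hz : ‖z‖ < 1)
    (hs : 0 ≤ s) (hK : ∀ p : ℂ, ∫⁻ θ, ‖1 - p * conjPhase θ‖ₑ ^ (-s) ∂μ ≤ K) (i j : ι) :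
    ∫⁻ ω, ‖green V z (Function.update (weights ω) i 0) i j‖ₑ ^ s
      ∂(Measure.infinitePi fun _ : ι => μ) ≤ K := by
  have hone : ∀ w : ι → Disc, w i = 0 → w j = 0 → ‖green V z w i j‖ₑ ^ s ≤ 1 := fun w hi hj => by
    refine ENNReal.rpow_le_one ?_ hs
    rw [← ofReal_norm, ENNReal.ofReal_le_one]
    exact norm_green_le_one hV hz hi hj
  have hm : Measurable fun ω => ‖green V z (Function.update (weights ω) i 0) i j‖ₑ ^ s :=
    ((continuous_green hV hz i j).comp
      (continuous_weights.update i continuous_const)).measurable.enorm.pow_const s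
  rcases eq_or_ne i j with rfl | hij
  · refine (lintegral_mono fun ω => hone _ (by simp) (by simp)).trans ?_
    simpa using one_le_of_forall_lintegral_rpow_neg_le hK
  · rw [← lintegral_infinitePi_update _ j hm]
    calc _ ≤ ∫⁻ _, K ∂(Measure.infinitePi fun _ : ι => μ) := by
          refine lintegral_mono fun ω => ?_
          simp only [weights_update, Function.update_comm hij.symm]
          refine (lintegral_green_update_le hV hz hs hK _ (Or.inr rfl)).trans ?_
          exact mul_le_of_le_one_left' (hone _ (by simp [hij]) (by simp))
      _ = K := by simp

theorem greenMoment_le (hV : V ∈ unitary (Ell2 ι →L[ℂ] Ell2 ι)) (hz : ‖z‖ < 1) (hs : 0 ≤ s)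
    (hK : ∀ p : ℂ, ∫⁻ θ, ‖1 - p * conjPhase θ‖ₑ ^ (-s) ∂μ ≤ K) (hKtop : K ≠ ⊤) (i j : ι) :
    greenMoment μ V z s i j ≤ K ^ 2 := by
  rw [greenMoment, ← lintegral_infinitePi_update _ i
    ((measurable_green_weights hV hz i j).enorm.pow_const s)]
  calc _ ≤ ∫⁻ ω, ‖green V z (Function.update (weights ω) i 0) i j‖ₑ ^ s * K
        ∂(Measure.infinitePi fun _ : ι => μ) := by
        refine lintegral_mono fun ω => ?_
        simp only [weights_update]
        exact lintegral_green_update_le hV hz hs hK _ (Or.inl rfl)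
    _ = (∫⁻ ω, ‖green V z (Function.update (weights ω) i 0) i j‖ₑ ^ s
        ∂(Measure.infinitePi fun _ : ι => μ)) * K := lintegral_mul_const' _ _ hKtop
    _ ≤ K ^ 2 := by
        rw [sq]
        gcongr
        exact lintegral_green_update_zero_le hV hz hs hK i j

theorem greenMoment_le_mul_lintegral (hV : V ∈ unitary (Ell2 ι →L[ℂ] Ell2 ι)) (hz : ‖z‖ < 1)
    (hs : 0 ≤ s) (hK : ∀ p : ℂ, ∫⁻ θ, ‖1 - p * conjPhase θ‖ₑ ^ (-s) ∂μ ≤ K) (hKtop : K ≠ ⊤)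
    (i j : ι) {q : (ι → Torus) → ℂ} (hqm : Measurable q) (hq1 : ∀ ω, ‖q ω‖ < 1)
    (hq : ∀ ω θ, q (Function.update ω i θ) = q ω) :
    greenMoment μ V z s i j
      ≤ 2 ^ s * K ^ 2 * ∫⁻ ω, ‖(1 - q ω * weights ω i) * green V z (weights ω) i j‖ₑ ^ s
        ∂Measure.infinitePi fun _ : ι => μ := by
  have hm := measurable_green_weights hV hz i j
  have hwm : Measurable fun ω : ι → Torus => (weights ω i : ℂ) :=
    (continuous_subtype_val.comp continuous_conjPhase).measurable.comp (measurable_pi_apply i)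
  have hprod : Measurable fun ω =>
      ‖(1 - q ω * weights ω i) * green V z (weights ω) i j‖ₑ ^ s := by fun_prop
  have hc : 2 ^ s * K ^ 2 ≠ ⊤ := ENNReal.mul_ne_top
    (ENNReal.rpow_ne_top_of_nonneg hs (by simp)) (ENNReal.pow_ne_top hKtop)
  rw [greenMoment, ← lintegral_infinitePi_update _ i (hm.enorm.pow_const s),
    ← lintegral_infinitePi_update _ i hprod, ← lintegral_const_mul' _ _ hc]
  refine lintegral_mono fun ω => ?_
  have hg := fun θ => enorm_green_update_rpow hV hz (weights ω) (Or.inl rfl : i = i ∨ i = j)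
    (conjPhase θ) hs
  simp only [weights_update, hq, Function.update_self, enorm_mul,
    ENNReal.mul_rpow_of_nonneg _ _ hs, hg]
  set a := ‖green V z (Function.update (weights ω) i 0) i j‖ₑ ^ s
  have ha : a ≠ ⊤ := ENNReal.rpow_ne_top_of_nonneg hs enorm_ne_top
  simp only [mul_left_comm _ a]
  rw [lintegral_const_mul' _ _ ha, lintegral_const_mul' _ _ ha, mul_left_comm]
  gcongr
  exact lintegral_rpow_neg_le_mul hs hK
    (norm_mul_green_update_zero_lt_one hV hz (weights ω) i).le (hq1 ω)

theorem greenMoment_le_of_convexComb (hV : V ∈ unitary (Ell2 ι →L[ℂ] Ell2 ι)) (hz : ‖z‖ < 1)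
    {p r θ : ℝ} (hp : 0 ≤ p) (hr : 0 ≤ r) (hθ0 : 0 ≤ θ) (hθ1 : θ ≤ 1) (i j : ι) :
    greenMoment μ V z (p * θ + r * (1 - θ)) i j
      ≤ greenMoment μ V z p i j ^ θ * greenMoment μ V z r i j ^ (1 - θ) :=
  lintegral_rpow_le_of_convexComb (measurable_green_weights hV hz i j).enorm hp hr hθ0 hθ1

end GreenMoment

/-! ### Unitarity of the walk -/

theorem mem_unitary_of_norm_map_of_surjective {E : Type*} [NormedAddCommGroup E]
    [InnerProductSpace ℂ E] [CompleteSpace E] {V : E →L[ℂ] E} (hV : ∀ ψ, ‖V ψ‖ = ‖ψ‖)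
    (hsurj : Function.Surjective V) : V ∈ unitary (E →L[ℂ] E) :=
  (Unitary.linearIsometryEquiv.symm
    (LinearIsometryEquiv.ofSurjective ⟨V.toLinearMap, hV⟩ hsurj)).2

section Walk

variable {d : ℕ} {C : Matrix (Coin d) (Coin d) ℂ} {ω : Phases d}

theorem wcomp_mem_unitary {f : Label d → Label d} (hf : Function.Bijective f) {w : Label d → ℂ}
    (hw : ∀ i, ‖w i‖ = 1) :
    wcomp f hf.injective w (fun i => (hw i).le) ∈ unitary (Hil d →L[ℂ] Hil d) := by
  let e := Equiv.ofBijective f hf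
  have hw' : ∀ i, ‖(w (e.symm i))⁻¹‖ ≤ 1 := fun i => by simp [hw]
  refine mem_unitary_of_norm_map_of_surjective (fun ψ => ?_) fun ψ =>
    ⟨wcomp e.symm e.symm.injective (fun i => (w (e.symm i))⁻¹) hw' ψ, ?_⟩
  · rw [← sq_eq_sq₀ (norm_nonneg _) (norm_nonneg _), norm_sq_eq_tsum, norm_sq_eq_tsum,
      ← e.tsum_eq fun i => ‖ψ i‖ ^ 2]
    refine tsum_congr fun i => ?_
    rw [wcomp_apply, norm_mul, hw, one_mul]
    rfl
  · ext i
    have hwi : w i ≠ 0 := norm_ne_zero_iff.1 (by rw [hw]; exact one_ne_zero)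
    have he : e.symm (f i) = i := e.symm_apply_apply i
    rw [wcomp_apply, wcomp_apply, he, mul_inv_cancel_left₀ hwi]

theorem shiftOp_mem_unitary (d : ℕ) : shiftOp d ∈ unitary (Hil d →L[ℂ] Hil d) :=
  wcomp_mem_unitary
    (Equiv.prodShear (Equiv.refl (Coin d)) fun τ => Equiv.subRight (jump τ)).bijective
    fun _ => norm_one

theorem phaseOp_mem_unitary (ω : Phases d) : phaseOp ω ∈ unitary (Hil d →L[ℂ] Hil d) :=
  wcomp_mem_unitary Function.bijective_id fun _ => Circle.norm_coe _

theorem coinOp_mul (A B : Matrix (Coin d) (Coin d) ℂ) :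
    coinOp A * coinOp B = coinOp (A * B) := by
  ext ψ ⟨τ, x⟩
  rw [mul_apply_eq_comp, coinOp_apply, coinOp_apply]
  simp only [coinOp_apply, Matrix.mul_apply, Finset.mul_sum, Finset.sum_mul]
  rw [Finset.sum_comm]
  simp only [mul_assoc]

theorem coinOp_one : coinOp (1 : Matrix (Coin d) (Coin d) ℂ) = 1 := by
  ext ψ ⟨τ, x⟩
  rw [coinOp_apply]
  simp [Matrix.one_apply]

theorem norm_coinOp_apply (hC : C ∈ Matrix.unitaryGroup (Coin d) ℂ) (ψ : Hil d) :
    ‖coinOp C ψ‖ = ‖ψ‖ := by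
  have hsum : ∀ φ : Hil d, ‖φ‖ ^ 2 = ∑' x, ∑ τ, ‖φ (τ, x)‖ ^ 2 := fun φ => by
    rw [norm_sq_eq_tsum, ← (Equiv.prodComm (Site d) (Coin d)).tsum_eq]
    refine (Summable.tsum_prod ((Equiv.prodComm (Site d) (Coin d)).summable_iff.2
      (summable_norm_sq φ))).trans ?_
    exact tsum_congr fun x => tsum_fintype _
  rw [← sq_eq_sq₀ (norm_nonneg _) (norm_nonneg _), hsum, hsum]
  refine tsum_congr fun x => ?_
  have h := ContinuousLinearMap.norm_map_of_mem_unitary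
    (Unitary.map_mem (Matrix.toEuclideanCLM (𝕜 := ℂ)) hC) (WithLp.toLp 2 fun σ => ψ (σ, x))
  rw [← sq_eq_sq₀ (norm_nonneg _) (norm_nonneg _), EuclideanSpace.norm_sq_eq,
    EuclideanSpace.norm_sq_eq] at h
  simp only [coinOp_apply]
  exact h

theorem coinOp_mem_unitary (hC : C ∈ Matrix.unitaryGroup (Coin d) ℂ) :
    coinOp C ∈ unitary (Hil d →L[ℂ] Hil d) := by
  refine mem_unitary_of_norm_map_of_surjective (norm_coinOp_apply hC) fun ψ =>
    ⟨coinOp (star C) ψ, ?_⟩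
  rw [← mul_apply_eq_comp, coinOp_mul, Unitary.mul_star_self_of_mem hC, coinOp_one]
  rfl

/-- The deterministic part `S (C ⊗ 𝕀)` of the evolution. -/
noncomputable def hop (C : Matrix (Coin d) (Coin d) ℂ) : Hil d →L[ℂ] Hil d :=
  shiftOp d * coinOp C

theorem hop_mem_unitary (hC : C ∈ Matrix.unitaryGroup (Coin d) ℂ) :
    hop C ∈ unitary (Hil d →L[ℂ] Hil d) :=
  mul_mem (shiftOp_mem_unitary d) (coinOp_mem_unitary hC)

theorem hop_apply (C : Matrix (Coin d) (Coin d) ℂ) (ψ : Hil d) (τ : Coin d) (x : Site d) :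
    hop C ψ (τ, x) = ∑ σ, C τ σ * ψ (σ, x - jump τ) := by
  rw [← coinOp_apply, ← one_mul (coinOp C ψ _)]
  rfl

theorem walk_mem_unitary (ω : Phases d) (hC : C ∈ Matrix.unitaryGroup (Coin d) ℂ) :
    walk ω C ∈ unitary (Hil d →L[ℂ] Hil d) :=
  mul_mem (phaseOp_mem_unitary ω) (hop_mem_unitary hC)

end Walk

/-! ### Following the cycles of the permutation -/

section Transport

variable {d : ℕ} {C : Matrix (Coin d) (Coin d) ℂ} {π : Equiv.Perm (Coin d)} {z : ℂ}

/-- The label `(π τ, x + r(π τ))` to which the unperturbed walk `S (C_π ⊗ 𝕀)` sends `(τ, x)`. -/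
def transport (π : Equiv.Perm (Coin d)) (i : Label d) : Label d :=
  (π i.1, i.2 + jump (π i.1))

theorem transport_iterate (π : Equiv.Perm (Coin d)) (n : ℕ) (i : Label d) :
    (transport π)^[n] i
      = ((π ^ n) i.1, i.2 + ∑ k ∈ Finset.range n, jump ((π ^ (k + 1)) i.1)) := by
  induction n with
  | zero => simp
  | succ n ih =>
    rw [Function.iterate_succ_apply', ih, transport, Finset.sum_range_succ, pow_succ' π n,
      add_assoc]
    rfl

theorem isPeriodicPt_transport (hπ : JumpsCancel π) (i : Label d) :
    Function.IsPeriodicPt (transport π) (Function.minimalPeriod π i.1) i := by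
  set m := Function.minimalPeriod π i.1
  have hm : (π ^ m) i.1 = i.1 := by
    rw [← Equiv.Perm.iterate_eq_pow]
    exact Function.iterate_minimalPeriod
  have hsum : ∑ k ∈ Finset.range m, jump ((π ^ (k + 1)) i.1) = 0 := by
    have h := Finset.sum_range_succ' (fun k => jump ((π ^ k) i.1)) m
    rw [Finset.sum_range_succ, hπ i.1, hm, zero_add, pow_zero, Equiv.Perm.one_apply] at h
    exact right_eq_add.1 h
  rw [Function.IsPeriodicPt, Function.IsFixedPt, transport_iterate, hm, hsum, add_zero]

theorem minimalPeriod_transport_pos (hπ : JumpsCancel π) (i : Label d) :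
    0 < Function.minimalPeriod (transport π) i :=
  (isPeriodicPt_transport hπ i).minimalPeriod_pos
    (Function.minimalPeriod_pos_of_mem_periodicPts (π.injective.mem_periodicPts i.1))

theorem minimalPeriod_transport_le (hπ : JumpsCancel π) (i : Label d) :
    Function.minimalPeriod (transport π) i ≤ orderOf π := by
  refine ((isPeriodicPt_transport hπ i).minimalPeriod_le
    (Function.minimalPeriod_pos_of_mem_periodicPts (π.injective.mem_periodicPts i.1))).trans ?_
  refine Function.IsPeriodicPt.minimalPeriod_le (orderOf_pos π) ?_
  rw [Function.IsPeriodicPt, Function.IsFixedPt, Equiv.Perm.iterate_eq_pow, pow_orderOf_eq_one,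
    Equiv.Perm.one_apply]

theorem norm_jump_le (τ : Coin d) : ‖jump τ‖ ≤ 1 := by
  refine (Pi.norm_single ..).trans_le ?_
  rcases Int.units_eq_one_or τ.2 with h | h <;> simp [h]

theorem norm_transport_iterate_sub_le (π : Equiv.Perm (Coin d)) (n : ℕ) (i : Label d) :
    ‖((transport π)^[n] i).2 - i.2‖ ≤ n := by
  rw [transport_iterate, add_sub_cancel_left]
  refine (norm_sum_le _ _).trans ((Finset.sum_le_sum fun k _ => norm_jump_le _).trans ?_)
  simp

theorem hop_apply_transport (C : Matrix (Coin d) (Coin d) ℂ) (π : Equiv.Perm (Coin d))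
    (ψ : Hil d) (i : Label d) :
    hop C ψ (transport π i)
      = ψ i + ∑ σ, (C - permCoin π) (π i.1) σ * ψ (σ, i.2) := by
  obtain ⟨τ, x⟩ := i
  rw [transport, hop_apply]
  simp only [Matrix.sub_apply, sub_mul, Finset.sum_sub_distrib, permCoin, Matrix.of_apply,
    add_sub_cancel_right]
  simp

theorem norm_entry_le_coinNorm (A : Matrix (Coin d) (Coin d) ℂ) (τ σ : Coin d) :
    ‖A τ σ‖ ≤ coinNorm A := by
  have h := (Matrix.toEuclideanCLM (𝕜 := ℂ) A).le_opNorm (EuclideanSpace.single σ 1)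
  rw [PiLp.norm_single, norm_one, mul_one] at h
  refine le_trans (le_of_eq ?_) ((PiLp.norm_apply_le _ τ).trans h)
  simp [EuclideanSpace.single]

theorem green_eq_transport (hC : C ∈ Matrix.unitaryGroup (Coin d) ℂ) (hz : ‖z‖ < 1)
    (w : Label d → Disc) {i j : Label d} (hij : transport π i ≠ j) :
    green (hop C) z w i j = z * w (transport π i) * green (hop C) z w (transport π i) j
      - ∑ σ, (C - permCoin π) (π i.1) σ * green (hop C) z w (σ, i.2) j := by
  have h := congrArg (fun φ : Hil d => φ (transport π i))
    (apply_inverse_single (hop_mem_unitary hC) hz w j)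
  rw [hop_apply_transport] at h
  simp only [lp.coeFn_add, Pi.add_apply, lp.coeFn_smul, Pi.smul_apply, diagOp_apply, smul_eq_mul,
    lp.single_apply_ne _ _ _ hij] at h
  simp only [green, entry]
  linear_combination h

theorem enorm_sub_prod_mul_le_sum {𝕜 : Type*} [NormedField 𝕜] {a c : ℕ → 𝕜} {n : ℕ}
    (hc : ∀ k < n, ‖c k‖ ≤ 1) :
    ‖a 0 - (∏ k ∈ Finset.range n, c k) * a n‖ₑ
      ≤ ∑ k ∈ Finset.range n, ‖a k - c k * a (k + 1)‖ₑ := by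
  induction n with
  | zero => simp
  | succ n ih =>
    set P := ∏ k ∈ Finset.range n, c k with hP
    have hP1 : ‖P‖ₑ ≤ 1 := by
      rw [← ofReal_norm, ENNReal.ofReal_le_one, norm_prod]
      exact Finset.prod_le_one (fun _ _ => norm_nonneg _) fun k hk =>
        hc k ((Finset.mem_range.1 hk).trans n.lt_succ_self)
    have hsplit : a 0 - P * c n * a (n + 1) = a 0 - P * a n + P * (a n - c n * a (n + 1)) := by
      ring
    rw [Finset.prod_range_succ, Finset.sum_range_succ, ← hP, hsplit]
    refine (enorm_add_le _ _).trans (add_le_add (ih fun k hk => hc k (hk.trans n.lt_succ_self)) ?_)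
    rw [enorm_mul]
    exact mul_le_of_le_one_left' hP1

theorem enorm_green_sub_transport_le (hC : C ∈ Matrix.unitaryGroup (Coin d) ℂ) (hz : ‖z‖ < 1)
    {δ : ENNReal} (hδ : ∀ τ σ, ‖(C - permCoin π) τ σ‖ₑ ≤ δ) (w : Label d → Disc) {i j : Label d}
    (hij : transport π i ≠ j) :
    ‖green (hop C) z w i j - z * w (transport π i) * green (hop C) z w (transport π i) j‖ₑ
      ≤ ∑ σ, δ * ‖green (hop C) z w (σ, i.2) j‖ₑ := by
  rw [green_eq_transport hC hz w hij, sub_sub_cancel_left, enorm_neg]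
  refine (enorm_sum_le _ _).trans (Finset.sum_le_sum fun σ _ => ?_)
  rw [enorm_mul]
  gcongr
  exact hδ _ _

theorem exists_prod_weights_eq_mul (hπ : JumpsCancel π) (hz : ‖z‖ < 1) (i : Label d) :
    ∃ q : Phases d → ℂ, Measurable q ∧ (∀ ω, ‖q ω‖ < 1) ∧
      (∀ ω θ, q (Function.update ω i θ) = q ω) ∧
      ∀ ω, ∏ k ∈ Finset.range (Function.minimalPeriod (transport π) i),
        z * (weights ω ((transport π)^[k + 1] i) : ℂ) = q ω * weights ω i := by
  obtain ⟨m, hm⟩ := Nat.exists_eq_add_one.2 (minimalPeriod_transport_pos hπ i)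
  have hw : ∀ l : Label d, Measurable fun ω : Phases d => (weights ω l : ℂ) := fun l =>
    (continuous_subtype_val.comp ((continuous_apply l).comp continuous_weights)).measurable
  refine ⟨fun ω => (∏ k ∈ Finset.range m, z * (weights ω ((transport π)^[k + 1] i) : ℂ)) * z,
    (Finset.measurable_fun_prod _ fun k _ => (hw _).const_mul z).mul_const z, fun ω => ?_,
    fun ω θ => ?_, fun ω => ?_⟩
  · rw [norm_mul, norm_prod]
    refine (mul_le_of_le_one_left (norm_nonneg _) (Finset.prod_le_one (fun _ _ => norm_nonneg _)
      fun k _ => ?_)).trans_lt hz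
    rw [norm_mul]
    exact mul_le_one₀ hz.le (norm_nonneg _) (Disc.norm_le _)
  · refine congrArg (· * z) (Finset.prod_congr rfl fun k hk => ?_)
    have hne : (transport π)^[k + 1] i ≠ i :=
      Function.not_isPeriodicPt_of_pos_of_lt_minimalPeriod k.succ_ne_zero
        (by rw [hm]; simpa using hk)
    rw [weights_update, Function.update_of_ne hne]
  · rw [hm, Finset.prod_range_succ, ← hm, Function.iterate_minimalPeriod, mul_assoc]

theorem enorm_one_sub_prod_mul_green_le (hC : C ∈ Matrix.unitaryGroup (Coin d) ℂ) (hz : ‖z‖ < 1)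
    {δ : ENNReal} (hδ : ∀ τ σ, ‖(C - permCoin π) τ σ‖ₑ ≤ δ) (w : Label d → Disc) {i j : Label d}
    (hij : ∀ k < Function.minimalPeriod (transport π) i, (transport π)^[k + 1] i ≠ j) :
    ‖(1 - ∏ k ∈ Finset.range (Function.minimalPeriod (transport π) i),
        z * (w ((transport π)^[k + 1] i) : ℂ)) * green (hop C) z w i j‖ₑ
      ≤ ∑ p ∈ Finset.range (Function.minimalPeriod (transport π) i) ×ˢ Finset.univ,
        δ * ‖green (hop C) z w (p.2, ((transport π)^[p.1] i).2) j‖ₑ := by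
  have h := enorm_sub_prod_mul_le_sum (n := Function.minimalPeriod (transport π) i)
    (a := fun k => green (hop C) z w ((transport π)^[k] i) j)
    (c := fun k => z * (w ((transport π)^[k + 1] i) : ℂ)) fun k _ => by
      rw [norm_mul]
      exact mul_le_one₀ hz.le (norm_nonneg _) (Disc.norm_le _)
  rw [Function.iterate_minimalPeriod, Function.iterate_zero_apply, ← one_sub_mul] at h
  rw [Finset.sum_product]
  refine h.trans (Finset.sum_le_sum fun k hk => ?_)
  have hk' := hij k (Finset.mem_range.1 hk)
  simp only [Function.iterate_succ_apply'] at hk' ⊢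
  exact enorm_green_sub_transport_le hC hz hδ w hk'

theorem greenMoment_le_sum {μ : Measure Torus} [IsProbabilityMeasure μ] {s : ℝ} {K : ENNReal}
    (hC : C ∈ Matrix.unitaryGroup (Coin d) ℂ) (hπ : JumpsCancel π) (hz : ‖z‖ < 1)
    (hs0 : 0 < s) (hs1 : s ≤ 1) (hK : ∀ p : ℂ, ∫⁻ θ, ‖1 - p * conjPhase θ‖ₑ ^ (-s) ∂μ ≤ K)
    (hKtop : K ≠ ⊤) {δ : ENNReal} (hδ : ∀ τ σ, ‖(C - permCoin π) τ σ‖ₑ ≤ δ) {i j : Label d}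
    (hij : ∀ k < Function.minimalPeriod (transport π) i, (transport π)^[k + 1] i ≠ j) :
    greenMoment μ (hop C) z s i j
      ≤ 2 ^ s * K ^ 2 *
        ∑ p ∈ Finset.range (Function.minimalPeriod (transport π) i) ×ˢ Finset.univ,
          δ ^ s * greenMoment μ (hop C) z s (p.2, ((transport π)^[p.1] i).2) j := by
  have hV := hop_mem_unitary hC
  have hm : ∀ l, Measurable fun ω : Phases d => ‖green (hop C) z (weights ω) l j‖ₑ := fun l =>
    (measurable_green_weights hV hz l j).enorm
  obtain ⟨q, hqm, hq1, hq, hprod⟩ := exists_prod_weights_eq_mul hπ hz i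
  refine (greenMoment_le_mul_lintegral hV hz hs0.le hK hKtop i j hqm hq1 hq).trans ?_
  gcongr
  calc _ ≤ ∫⁻ ω, (∑ p ∈ Finset.range (Function.minimalPeriod (transport π) i) ×ˢ Finset.univ,
        δ * ‖green (hop C) z (weights ω) (p.2, ((transport π)^[p.1] i).2) j‖ₑ) ^ s
        ∂(Measure.infinitePi fun _ : Label d => μ) := by
        gcongr with ω
        rw [← hprod]
        exact enorm_one_sub_prod_mul_green_le hC hz hδ (weights ω) hij
    _ ≤ _ := lintegral_rpow_sum_le _ (fun p => (hm _).const_mul δ) hs0 hs1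
    _ = _ := Finset.sum_congr rfl fun p _ => by
        simp only [ENNReal.mul_rpow_of_nonneg _ _ hs0.le]
        exact lintegral_const_mul _ ((hm _).pow_const s)

end Transport

/-! ### Exponential decay -/

section Decay

theorem le_mul_exp_of_forall_le_half {α : Type*} {f : α → ENNReal} {ρ : α → ℝ} {R : ℝ}
    {A : ENNReal} (hR : 0 < R) (hρ : ∀ i, 0 ≤ ρ i) (hA : ∀ i, f i ≤ A)
    (hstep : ∀ i b, R ≤ ρ i → (∀ i', ρ i - R ≤ ρ i' → f i' ≤ b) → f i ≤ b / 2) (i : α) :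
    f i ≤ 2 * A * ENNReal.ofReal (Real.exp (-(Real.log 2 / R) * ρ i)) := by
  have hiter : ∀ n : ℕ, ∀ i, n * R ≤ ρ i → f i ≤ A * 2⁻¹ ^ n := fun n => by
    induction n with
    | zero => simpa using fun i _ => hA i
    | succ n ih =>
      intro i hi
      push_cast at hi
      have hn : 0 ≤ n * R := by positivity
      rw [pow_succ, ← mul_assoc, ← div_eq_mul_inv]
      exact hstep i _ (by linarith) fun i' hi' => ih i' (by linarith)
  set n := ⌊ρ i / R⌋₊
  have hn : n * R ≤ ρ i := (le_div_iff₀ hR).1 (Nat.floor_le (div_nonneg (hρ i) hR.le))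
  have hexp : (2⁻¹ : ℝ) ^ n ≤ 2 * Real.exp (-(Real.log 2 / R) * ρ i) := by
    have hlt : ρ i / R < n + 1 := Nat.lt_floor_add_one _
    have : 0 < Real.log 2 := Real.log_pos one_lt_two
    calc (2⁻¹ : ℝ) ^ n = 2 * Real.exp (-Real.log 2 * (n + 1)) := by
          rw [mul_add_one, Real.exp_add, mul_comm _ (n : ℝ), Real.exp_nat_mul, Real.exp_neg,
            Real.exp_log two_pos]
          ring
      _ ≤ 2 * Real.exp (-(Real.log 2 / R) * ρ i) := by
          have hassoc : Real.log 2 / R * ρ i = Real.log 2 * (ρ i / R) := by ring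
          rw [neg_mul, neg_mul, hassoc]
          gcongr
  calc f i ≤ A * 2⁻¹ ^ n := hiter n i hn
    _ = A * ENNReal.ofReal (2⁻¹ ^ n) := by
        rw [ENNReal.ofReal_pow (by positivity), ENNReal.ofReal_inv_of_pos two_pos,
          ENNReal.ofReal_ofNat]
    _ ≤ A * ENNReal.ofReal (2 * Real.exp (-(Real.log 2 / R) * ρ i)) := by gcongr
    _ = _ := by
        rw [ENNReal.ofReal_mul two_pos.le, ENNReal.ofReal_ofNat]
        ring

variable {d : ℕ} {C : Matrix (Coin d) (Coin d) ℂ} {π : Equiv.Perm (Coin d)} {z : ℂ}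
  {μ : Measure Torus} [IsProbabilityMeasure μ] {s : ℝ}

theorem greenMoment_le_half {K : ENNReal} (hC : C ∈ Matrix.unitaryGroup (Coin d) ℂ)
    (hπ : JumpsCancel π) (hz : ‖z‖ < 1) (hs0 : 0 < s) (hs1 : s ≤ 1)
    (hK : ∀ p : ℂ, ∫⁻ θ, ‖1 - p * conjPhase θ‖ₑ ^ (-s) ∂μ ≤ K) (hKtop : K ≠ ⊤) {δ : ENNReal}
    (hδ : ∀ τ σ, ‖(C - permCoin π) τ σ‖ₑ ≤ δ)
    (hsmall : 2 ^ s * K ^ 2 * (orderOf π * Fintype.card (Coin d) * δ ^ s) ≤ 2⁻¹) {i j : Label d}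
    (hij : orderOf π < ‖i.2 - j.2‖) {b : ENNReal}
    (hb : ∀ i' : Label d, ‖i'.2 - i.2‖ ≤ orderOf π → greenMoment μ (hop C) z s i' j ≤ b) :
    greenMoment μ (hop C) z s i j ≤ b / 2 := by
  have hperiod := minimalPeriod_transport_le hπ i
  have hnear : ∀ k ≤ orderOf π, ‖((transport π)^[k] i).2 - i.2‖ ≤ orderOf π := fun k hk =>
    (norm_transport_iterate_sub_le π k i).trans (Nat.cast_le.2 hk)
  have hne : ∀ k < Function.minimalPeriod (transport π) i, (transport π)^[k + 1] i ≠ j := by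
    rintro k hk rfl
    rw [norm_sub_rev] at hij
    exact hij.not_ge (hnear (k + 1) (by lia))
  calc greenMoment μ (hop C) z s i j
      ≤ 2 ^ s * K ^ 2 * ∑ p ∈ Finset.range (Function.minimalPeriod (transport π) i) ×ˢ Finset.univ,
          δ ^ s * greenMoment μ (hop C) z s (p.2, ((transport π)^[p.1] i).2) j :=
        greenMoment_le_sum hC hπ hz hs0 hs1 hK hKtop hδ hne
    _ ≤ 2 ^ s * K ^ 2 *
          ∑ _p ∈ Finset.range (Function.minimalPeriod (transport π) i) ×ˢ
            (Finset.univ : Finset (Coin d)), δ ^ s * b := by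
        gcongr with p hp
        obtain ⟨hp, -⟩ := Finset.mem_product.1 hp
        exact hb _ (hnear p.1 ((Finset.mem_range.1 hp).le.trans hperiod))
    _ ≤ 2 ^ s * K ^ 2 * (orderOf π * Fintype.card (Coin d) * (δ ^ s * b)) := by
        rw [Finset.sum_const, Finset.card_product, Finset.card_range, nsmul_eq_mul, Nat.cast_mul]
        gcongr
        exact Finset.card_univ.le
    _ = 2 ^ s * K ^ 2 * (orderOf π * Fintype.card (Coin d) * δ ^ s) * b := by ring
    _ ≤ b / 2 := by
        rw [ENNReal.div_eq_inv_mul]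
        gcongr

theorem exists_pos_mul_rpow_le (N : NNReal) (hs : 0 < s) :
    ∃ δ : ℝ, 0 < δ ∧ N * ENNReal.ofReal δ ^ s ≤ 2⁻¹ := by
  have hlim : Filter.Tendsto (fun δ : ℝ => N * ENNReal.ofReal δ ^ s) (nhdsWithin 0 (Set.Ioi 0))
      (nhds 0) := by
    have hcont : Continuous fun δ : ℝ => (N : ENNReal) * ENNReal.ofReal δ ^ s :=
      (ENNReal.continuous_const_mul ENNReal.coe_ne_top).comp
        (ENNReal.continuous_rpow_const.comp ENNReal.continuous_ofReal)
    simpa [hs] using (hcont.tendsto 0).mono_left nhdsWithin_le_nhds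
  obtain ⟨δ, hδ, hpos⟩ := ((hlim.eventually_le_const (by simp : (0 : ENNReal) < 2⁻¹)).and
    self_mem_nhdsWithin).exists
  exact ⟨δ, hpos, hδ⟩

theorem exists_greenMoment_le_exp_of_rpow (hμ : HasBoundedDensity μ) (hπ : JumpsCancel π)
    (hs0 : 0 < s) (hs1 : s < 1) :
    ∃ δ : ℝ, 0 < δ ∧ ∃ γ : ℝ, 0 < γ ∧ ∃ B : NNReal,
      ∀ C ∈ Matrix.unitaryGroup (Coin d) ℂ, coinNorm (C - permCoin π) ≤ δ →
      ∀ z : ℂ, ‖z‖ < 1 → ∀ i j : Label d, greenMoment μ (hop C) z s i j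
        ≤ B * ENNReal.ofReal (Real.exp (-γ * ‖i.2 - j.2‖)) := by
  obtain ⟨K, hK⟩ := exists_lintegral_rpow_neg_le hμ hs0.le hs1
  obtain ⟨δ, hδ0, hδ⟩ := exists_pos_mul_rpow_le
    (2 ^ s * K ^ 2 * (orderOf π * Fintype.card (Coin d)) : NNReal) hs0
  refine ⟨δ, hδ0, Real.log 2 / (orderOf π + 1), by positivity, 2 * K ^ 2,
    fun C hC hCδ z hz i j => ?_⟩
  have hentry : ∀ τ σ, ‖(C - permCoin π) τ σ‖ₑ ≤ ENNReal.ofReal δ := fun τ σ => by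
    rw [← ofReal_norm]
    exact ENNReal.ofReal_le_ofReal ((norm_entry_le_coinNorm _ τ σ).trans hCδ)
  have hsmall : 2 ^ s * (K : ENNReal) ^ 2 *
      (orderOf π * Fintype.card (Coin d) * ENNReal.ofReal δ ^ s) ≤ 2⁻¹ := by
    push_cast [ENNReal.coe_rpow_of_nonneg _ hs0.le] at hδ
    rwa [← mul_assoc]
  push_cast
  refine le_mul_exp_of_forall_le_half (f := fun i => greenMoment μ (hop C) z s i j)
    (ρ := fun i => ‖i.2 - j.2‖) (by positivity) (fun i => norm_nonneg _)
    (fun i => greenMoment_le (hop_mem_unitary hC) hz hs0.le hK ENNReal.coe_ne_top i j)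
    (fun i b hi hb => greenMoment_le_half hC hπ hz hs0 hs1.le hK ENNReal.coe_ne_top hentry hsmall
      (by linarith) fun i' hi' => hb i' ?_) i
  have := norm_sub_le_norm_sub_add_norm_sub i.2 i'.2 j.2
  rw [norm_sub_rev] at hi'
  linarith

theorem exists_convexComb_half_eq (hs0 : 0 < s) (hs1 : s < 1) :
    ∃ θ r : ℝ, 0 < θ ∧ θ ≤ 1 ∧ 0 ≤ r ∧ r < 1 ∧ 1 / 2 * θ + r * (1 - θ) = s := by
  have hθ : 0 < 1 - s * (1 - s) := by nlinarith
  refine ⟨s * (1 - s), (s - s * (1 - s) / 2) / (1 - s * (1 - s)), by nlinarith, by linarith,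
    div_nonneg (by nlinarith) hθ.le, (div_lt_one hθ).2 (by nlinarith), ?_⟩
  rw [div_mul_cancel₀ _ hθ.ne']
  ring

theorem exists_greenMoment_le_exp (hμ : HasBoundedDensity μ) (hπ : JumpsCancel π) :
    ∃ δ : ℝ, 0 < δ ∧ ∀ s : ℝ, 0 < s → s < 1 → ∃ γ : ℝ, 0 < γ ∧ ∃ B : NNReal,
      ∀ C ∈ Matrix.unitaryGroup (Coin d) ℂ, coinNorm (C - permCoin π) ≤ δ →
      ∀ z : ℂ, ‖z‖ < 1 → ∀ i j : Label d, greenMoment μ (hop C) z s i j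
        ≤ B * ENNReal.ofReal (Real.exp (-γ * ‖i.2 - j.2‖)) := by
  obtain ⟨δ, hδ, γ, hγ, B, hdecay⟩ :=
    exists_greenMoment_le_exp_of_rpow hμ hπ one_half_pos one_half_lt_one
  refine ⟨δ, hδ, fun s hs0 hs1 => ?_⟩
  obtain ⟨θ, r, hθ0, hθ1, hr0, hr1, rfl⟩ := exists_convexComb_half_eq hs0 hs1
  obtain ⟨K, hK⟩ := exists_lintegral_rpow_neg_le hμ hr0 hr1
  refine ⟨γ * θ, by positivity, B ^ θ * (K ^ 2) ^ (1 - θ), fun C hC hCδ z hz i j => ?_⟩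
  have hV := hop_mem_unitary hC
  calc greenMoment μ (hop C) z (1 / 2 * θ + r * (1 - θ)) i j
      ≤ greenMoment μ (hop C) z (1 / 2) i j ^ θ * greenMoment μ (hop C) z r i j ^ (1 - θ) :=
        greenMoment_le_of_convexComb hV hz one_half_pos.le hr0 hθ0.le hθ1 i j
    _ ≤ (B * ENNReal.ofReal (Real.exp (-γ * ‖i.2 - j.2‖))) ^ θ * ((K : ENNReal) ^ 2) ^ (1 - θ) := by
        gcongr
        · exact hdecay C hC hCδ z hz i j
        · exact greenMoment_le hV hz hr0 hK ENNReal.coe_ne_top i j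
    _ = _ := by
        rw [ENNReal.mul_rpow_of_nonneg _ _ hθ0.le,
          ENNReal.ofReal_rpow_of_nonneg (Real.exp_pos _).le hθ0.le, ← Real.exp_mul]
        push_cast [ENNReal.coe_rpow_of_nonneg _ hθ0.le,
          ENNReal.coe_rpow_of_nonneg _ (sub_nonneg.2 hθ1)]
        ring_nf

end Decay

/-! ### The resolvent of the walk -/

section Resolvent

theorem isUnit_unitary_sub_smul_one {A : Type*} [CStarAlgebra A] {U : A} (hU : U ∈ unitary A)
    {z : ℂ} (hz : ‖z‖ ≠ 1) : IsUnit (U - z • 1) := by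
  have h : z ∉ spectrum ℂ U := fun h =>
    hz (by simpa using Unitary.spectrum_subset_circle (𝕜 := ℂ) ⟨U, hU⟩ h)
  rw [spectrum.notMem_iff, Algebra.algebraMap_eq_smul_one] at h
  rwa [← neg_sub, IsUnit.neg_iff]

theorem inverse_unitary_sub_smul_one {A : Type*} [CStarAlgebra A] {U : A} (hU : U ∈ unitary A)
    {z : ℂ} (hz0 : z ≠ 0) (hz : ‖z‖ ≠ 1) :
    Ring.inverse (U - z • 1)
      = -z⁻¹ • (1 + z⁻¹ • star (Ring.inverse (U - (star z)⁻¹ • 1))) := by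
  have hz' : ‖(star z)⁻¹‖ ≠ 1 := by simpa using hz
  set R := Ring.inverse (U - (star z)⁻¹ • 1)
  have hR : star U * star R = 1 + z⁻¹ • star R := by
    have h := congrArg star (Ring.inverse_mul_cancel _ (isUnit_unitary_sub_smul_one hU hz'))
    simp only [star_mul, star_sub, star_smul, star_one, star_inv₀, star_star, sub_mul,
      smul_mul_assoc, one_mul] at h
    exact sub_eq_iff_eq_add.1 h
  have hUR : U * (1 + z⁻¹ • star R) = star R := by
    rw [← hR, ← mul_assoc, Unitary.mul_star_self_of_mem hU, one_mul]
  rw [← mul_one (Ring.inverse _),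
    Ring.inverse_mul_eq_iff_eq_mul _ _ _ (isUnit_unitary_sub_smul_one hU hz), mul_smul_comm,
    sub_mul, hUR, smul_mul_assoc, one_mul, smul_add, smul_inv_smul₀ hz0,
    sub_add_cancel_right, smul_neg, neg_smul, neg_neg, inv_smul_smul₀ hz0]

theorem entry_mul_diagOp {ι : Type*} [DecidableEq ι] (A : Ell2 ι →L[ℂ] Ell2 ι) (w : ι → Disc)
    (i j : ι) : entry (A * diagOp w) i j = w j * entry A i j := by
  have h : diagOp w (lp.single 2 j 1) = (w j : ℂ) • (lp.single 2 j 1 : Ell2 ι) := by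
    ext k
    rw [diagOp_apply, lp.coeFn_smul, Pi.smul_apply, smul_eq_mul, lp.single_apply]
    rcases eq_or_ne k j with rfl | hk
    · rfl
    · rw [Pi.single_eq_of_ne hk, mul_zero, mul_zero]
  rw [entry, mul_apply_eq_comp, h, map_smul, lp.coeFn_smul, Pi.smul_apply, smul_eq_mul, entry]

variable {d : ℕ} {C : Matrix (Coin d) (Coin d) ℂ} {z : ℂ}

theorem phaseOp_mul_diagOp_weights (ω : Phases d) : phaseOp ω * diagOp (weights ω) = 1 := by
  ext ψ i
  change (AddCircle.toCircle (ω i) : ℂ) * (conjPhase (ω i) * ψ i) = ψ i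
  rw [← mul_assoc, mul_comm (AddCircle.toCircle _ : ℂ), conjPhase_mul_toCircle, one_mul]

theorem inverse_phaseOp (ω : Phases d) : Ring.inverse (phaseOp ω) = diagOp (weights ω) := by
  rw [← mul_one (Ring.inverse _), Ring.inverse_mul_eq_iff_eq_mul _ _ _
    (Unitary.isUnit_coe (U := ⟨_, phaseOp_mem_unitary ω⟩)), phaseOp_mul_diagOp_weights]

theorem res_eq (ω : Phases d) (C : Matrix (Coin d) (Coin d) ℂ) (z : ℂ) :
    res ω C z = Ring.inverse (hop C - z • diagOp (weights ω)) * diagOp (weights ω) := by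
  have hfactor : walk ω C - z • ContinuousLinearMap.id ℂ (Hil d)
      = phaseOp ω * (hop C - z • diagOp (weights ω)) := by
    rw [mul_sub, mul_smul_comm, phaseOp_mul_diagOp_weights]
    rfl
  rw [res, hfactor, Ring.inverse_mul
    (Or.inl (Unitary.isUnit_coe (U := ⟨_, phaseOp_mem_unitary ω⟩))), inverse_phaseOp]

theorem entry_res (ω : Phases d) (C : Matrix (Coin d) (Coin d) ℂ) (z : ℂ) (i j : Label d) :
    entry (res ω C z) i j = weights ω j * green (hop C) z (weights ω) i j := by
  rw [res_eq, entry_mul_diagOp, green]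

theorem entry_res_eq_star (hC : C ∈ Matrix.unitaryGroup (Coin d) ℂ) (hz0 : z ≠ 0) (hz : ‖z‖ ≠ 1)
    (ω : Phases d) (i j : Label d) :
    entry (res ω C z) i j = -z⁻¹ *
      ((if i = j then 1 else 0) + z⁻¹ * star (entry (res ω C (star z)⁻¹) j i)) := by
  rw [← entry_star, ← entry_one]
  exact congrArg (entry · i j) (inverse_unitary_sub_smul_one (walk_mem_unitary ω hC) hz0 hz)

theorem measurable_entry_res (hC : C ∈ Matrix.unitaryGroup (Coin d) ℂ) (hz : ‖z‖ ≠ 1)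
    (i j : Label d) : Measurable fun ω => entry (res ω C z) i j := by
  have hlt : ∀ {z : ℂ}, ‖z‖ < 1 → ∀ i j, Measurable fun ω => entry (res ω C z) i j :=
    fun hz i j => by
      have hw : Measurable fun ω : Phases d => (weights ω j : ℂ) :=
        (continuous_subtype_val.comp ((continuous_apply j).comp continuous_weights)).measurable
      simp only [entry_res]
      exact hw.mul (measurable_green_weights (hop_mem_unitary hC) hz i j)
  rcases hz.lt_or_gt with hz | hz
  · exact hlt hz i j
  · have hz' : ‖(star z)⁻¹‖ < 1 := by simpa using inv_lt_one_of_one_lt₀ hz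
    simp only [entry_res_eq_star hC (norm_pos_iff.1 (one_pos.trans hz)) hz.ne']
    exact ((continuous_star.measurable.comp (hlt hz' j i)).const_mul _).const_add _ |>.const_mul _

theorem norm_entry_res (ω : Phases d) (C : Matrix (Coin d) (Coin d) ℂ) (z : ℂ) (i j : Label d) :
    ‖entry (res ω C z) i j‖ = ‖green (hop C) z (weights ω) i j‖ := by
  rw [entry_res, norm_mul, weights, Function.comp_apply, norm_conjPhase, one_mul]

theorem norm_entry_res_le_of_one_lt_norm (hC : C ∈ Matrix.unitaryGroup (Coin d) ℂ) (hz : 1 < ‖z‖)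
    (ω : Phases d) (i j : Label d) :
    ‖entry (res ω C z) i j‖
      ≤ (if i = j then 1 else 0) + ‖green (hop C) (star z)⁻¹ (weights ω) j i‖ := by
  have hinv : ‖z⁻¹‖ ≤ 1 := by simpa using (inv_lt_one_of_one_lt₀ hz).le
  rw [entry_res_eq_star hC (norm_pos_iff.1 (one_pos.trans hz)) hz.ne', norm_mul, norm_neg,
    ← norm_entry_res]
  refine (mul_le_of_le_one_left (norm_nonneg _) hinv).trans ((norm_add_le _ _).trans ?_)
  rw [norm_mul, norm_star]
  gcongr
  · split_ifs <;> simp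
  · exact mul_le_of_le_one_left (norm_nonneg _) hinv

theorem lintegral_enorm_entry_res_rpow_le {μ : Measure Torus} [IsProbabilityMeasure μ] {s γ : ℝ}
    {B : NNReal} (hC : C ∈ Matrix.unitaryGroup (Coin d) ℂ) (hs0 : 0 < s) (hs1 : s ≤ 1)
    (hB : ∀ z : ℂ, ‖z‖ < 1 → ∀ i j : Label d, greenMoment μ (hop C) z s i j
        ≤ B * ENNReal.ofReal (Real.exp (-γ * ‖i.2 - j.2‖)))
    (hz : ‖z‖ ≠ 1) (i j : Label d) :
    ∫⁻ ω, ‖entry (res ω C z) i j‖ₑ ^ s ∂(phaseLaw d μ)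
      ≤ (1 + B) * ENNReal.ofReal (Real.exp (-γ * ‖i.2 - j.2‖)) := by
  rcases hz.lt_or_gt with hz | hz
  · simp only [← ofReal_norm, norm_entry_res]
    simp only [ofReal_norm]
    exact (hB z hz i j).trans (by gcongr; exact le_add_self)
  have hz' : ‖(star z)⁻¹‖ < 1 := by simpa using inv_lt_one_of_one_lt₀ hz
  have hdiag : (if i = j then 1 else 0) ≤ ENNReal.ofReal (Real.exp (-γ * ‖i.2 - j.2‖)) := by
    split_ifs with hij
    · simp [hij]
    · exact zero_le
  have hpt : ∀ ω, ‖entry (res ω C z) i j‖ₑ ^ s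
      ≤ (if i = j then 1 else 0) + ‖green (hop C) (star z)⁻¹ (weights ω) j i‖ₑ ^ s := fun ω => by
    have h := ENNReal.ofReal_le_ofReal (norm_entry_res_le_of_one_lt_norm hC hz ω i j)
    rw [ENNReal.ofReal_add (by split_ifs <;> simp) (norm_nonneg _), ofReal_norm, ofReal_norm] at h
    refine (ENNReal.rpow_le_rpow h hs0.le).trans
      ((ENNReal.rpow_add_le_add_rpow _ _ hs0.le hs1).trans ?_)
    gcongr
    split_ifs <;> simp [hs0]
  calc ∫⁻ ω, ‖entry (res ω C z) i j‖ₑ ^ s ∂(phaseLaw d μ)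
      ≤ (if i = j then 1 else 0) + greenMoment μ (hop C) (star z)⁻¹ s j i := by
        refine (lintegral_mono hpt).trans ?_
        rw [lintegral_add_left measurable_const, lintegral_const, phaseLaw, measure_univ, mul_one,
          greenMoment]
    _ ≤ _ := by
        rw [one_add_mul]
        refine add_le_add hdiag ?_
        rw [norm_sub_rev]
        exact hB _ hz' j i

end Resolvent

end QWalk

theorem theorem2_general {d : ℕ} {μ : Measure Torus} [IsProbabilityMeasure μ]
    (hμ : HasBoundedDensity μ) {π : Equiv.Perm (Coin d)} (hπ : JumpsCancel π) :
    ∃ δ : ℝ, 0 < δ ∧ ∀ s : ℝ, 0 < s → s < 1 →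
      ∃ γ : ℝ, 0 < γ ∧ ∃ c : ℝ, 0 < c ∧
        ∀ C ∈ Matrix.unitaryGroup (Coin d) ℂ, coinNorm (C - permCoin π) ≤ δ →
        ∀ x y : Site d, ∀ τ σ : Coin d, ∀ z : ℂ, ‖z‖ ≠ 1 →
          (∀ ω : Phases d, IsUnit (walk ω C - z • ContinuousLinearMap.id ℂ (Hil d))) ∧
          Integrable (fun ω : Phases d => ‖inner ℂ (ket τ x) (res ω C z (ket σ y))‖ ^ s)
            (phaseLaw d μ) ∧
          ∫ ω : Phases d, ‖inner ℂ (ket τ x) (res ω C z (ket σ y))‖ ^ s ∂(phaseLaw d μ)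
            ≤ c * Real.exp (-γ * ‖x - y‖) := by
  obtain ⟨δ, hδ, h⟩ := exists_greenMoment_le_exp hμ hπ
  refine ⟨δ, hδ, fun s hs0 hs1 => ?_⟩
  obtain ⟨γ, hγ, B, hB⟩ := h s hs0 hs1
  refine ⟨γ, hγ, 1 + B, by positivity, fun C hC hCπ x y τ σ z hz =>
    ⟨fun ω => isUnit_unitary_sub_smul_one (walk_mem_unitary ω hC) hz, ?_⟩⟩
  have hmoment := lintegral_enorm_entry_res_rpow_le hC hs0 hs1.le (hB C hC hCπ) hz (τ, x) (σ, y)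
  simp only [ket, inner_single_apply_single]
  refine integrable_and_integral_le_of_lintegral_enorm_rpow_le
    (measurable_entry_res hC hz _ _).aestronglyMeasurable hs0.le (by positivity)
    (hmoment.trans_eq ?_)
  rw [ENNReal.ofReal_mul (by positivity), ENNReal.ofReal_add zero_le_one B.coe_nonneg,
    ENNReal.ofReal_one, ENNReal.ofReal_coe_nnreal]

theorem theorem2 (d : ℕ) (hd : 1 ≤ d)
    (μ : Measure Torus) [IsProbabilityMeasure μ] (hμ : HasBoundedDensity μ)
    (π : Equiv.Perm (Coin d)) (hπ : JumpsCancel π) :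
    ∃ δ : ℝ, 0 < δ ∧ ∀ s : ℝ, 0 < s → s < 1 / 3 →
      ∃ γ : ℝ, 0 < γ ∧ ∃ c : ℝ, 0 < c ∧
        ∀ C ∈ Matrix.unitaryGroup (Coin d) ℂ, coinNorm (C - permCoin π) ≤ δ →
        ∀ x y : Site d, 2 < ‖x - y‖ →
        ∀ τ σ : Coin d,
        ∀ z : ℂ, 1 / 2 < ‖z‖ → ‖z‖ < 2 → ‖z‖ ≠ 1 →
          (∀ ω : Phases d, IsUnit (walk ω C - z • ContinuousLinearMap.id ℂ (Hil d))) ∧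
          Integrable (fun ω : Phases d => ‖inner ℂ (ket τ x) (res ω C z (ket σ y))‖ ^ s)
            (phaseLaw d μ) ∧
          ∫ ω : Phases d, ‖inner ℂ (ket τ x) (res ω C z (ket σ y))‖ ^ s ∂(phaseLaw d μ)
            ≤ c * Real.exp (-γ * ‖x - y‖) := by
  obtain ⟨δ, hδ, h⟩ := theorem2_general hμ hπ
  refine ⟨δ, hδ, fun s hs0 hs1 => ?_⟩
  obtain ⟨γ, hγ, c, hc, hbound⟩ := h s hs0 (hs1.trans (by norm_num))
  exact ⟨γ, hγ, c, hc, fun C hC hCπ x y _ τ σ z _ _ hz => hbound C hC hCπ x y τ σ z hz⟩
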